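/- Let $X=(X_t)_{t\in[0,1]}$ be a stochastic process with sample paths in $C[0,1]$ whose univariate marginal distribution functions $F_t(x)=P(X_t\le x)$, $t\in[0,1]$, are continuous, and let $U=(F_t(X_t))_{t\in[0,1]}$ be its copula process. Let $Z=(Z_t)_{t\in[0,1]}$ be a generator process, i.e. a process with continuous sample paths, $0\le Z_t\le q$ for all $t$ and some constant $q$, and $E(Z_t)=1$ for all $t$, and put $\|f\|_D=E\bigl(\sup_{t\in[0,1]}|f(t)|Z_t\bigr)$. Suppose that for some $\delta>0$ $$P\bigl(U_t\le 1+cf(t)\text{ for all }t\in[0,1]\bigr)=1-c\,\|f\|_D+O(c^{1+\delta})\qquad (c\downarrow0)$$ uniformly for all $f:[0,1]\to(-\infty,0]$ that are bounded, have only finitely many discontinuities and satisfy $\|f\|_\infty\le1$. For each $n$ choose a grid $0=t^{(n)}_1<\dots<t^{(n)}_{d_n}=1$ with $d_n\to\infty$ and $\max_{1\le i\le d_n-1}|t^{(n)}_{i+1}-t^{(n)}_i|\to0$ as $n\to\infty$. Let $X^{(1)},X^{(2)},\dots$ be independent copies of $X$, fix $k\in\{2,3,\dots\}$, let $M(n)\subset\{1,\dots,n\}$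 have $m_n$ elements, let $\hat F_{n,r}$ be the empirical distribution function of $X^{(1)}_{t^{(n)}_r},\dots,X^{(n)}_{t^{(n)}_r}$, and write $H^{-1}(q)=\inf\{x\in\mathbb R: H(x)\ge q\}$. For $1\le j\le k$ let $\hat n_j(c)$ be the number of those $i\in M(n)$ for which $X^{(i)}_{t^{(n)}_r}>\hat F_{n,r}^{-1}(1-c/j)$ for at least one $r\in\{1,\dots,d_n\}$, and put $$\hat T_n(c)=\frac{\sum_{j=1}^k\Bigl(j\,\hat n_j(c)-\frac1k\sum_{\ell=1}^k\ell\,\hat n_\ell(c)\Bigr)^2}{\frac1k\sum_{\ell=1}^k\ell\,\hat n_\ell(c)}.$$ Suppose that, as $n\to\infty$, $m_n\to\infty$, $c_n\to0$, $m_nc_n\to\infty$, $m_nc_n^{1+\delta}\to0$, $m_n^2\log(m_n)\,c_n/n\to0$ and $d_n^2/(m_nc_n)\to0$. Then $$\hat T_n(c_n)\to_D\sum_{i=1}^{k-1}\lambda_i\xi_i^2,\qquad \lambda_i=\frac1{4\sin^2\bigl(\frac ik\,\frac\pi2\bigr)},$$ where $\xi_1,\dots,\xi_{k-1}$ are independent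 standard normal random variables. -/

import Mathlib

open MeasureTheory ProbabilityTheory Filter Topology
open scoped unitInterval

noncomputable section

/-- The class `E⁻[0,1]` of bounded functions `f : [0,1] → ℝ` that have only finitely many
discontinuities and attain only nonpositive values. -/
structure IsEMinus (f : I → ℝ) : Prop where
  bounded : ∃ B : ℝ, ∀ t, |f t| ≤ B
  finite_discontinuities : {t | ¬ ContinuousAt f t}.Finite
  nonpos : ∀ t, f t ≤ 0

/-- A generator process: continuous sample paths, `0 ≤ Z_t ≤ q` for all `t` and some constant
`q`, and `E(Z_t) = 1` for all `t`. -/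
structure IsGenerator {Ω : Type*} [MeasurableSpace Ω] (P : Measure Ω) (Z : Ω → C(I, ℝ)) :
    Prop where
  aemeasurable : AEMeasurable (fun ω (t : I) => Z ω t) P
  bounded : ∃ q : ℝ, ∀ᵐ ω ∂P, ∀ t, 0 ≤ Z ω t ∧ Z ω t ≤ q
  integral_eq_one : ∀ t, ∫ ω, Z ω t ∂P = 1

/-- The functional `D`-norm `‖f‖_D = E (sup_t |f t| Z_t)`. -/
def functionalDNorm {Ω : Type*} [MeasurableSpace Ω] (P : Measure Ω) (Z : Ω → C(I, ℝ))
    (f : I → ℝ) : ℝ :=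
  ∫ ω, ⨆ t : I, |f t| * Z ω t ∂P

/-- The expansion `P(U ≤ 1 + c f) = 1 - c ‖f‖_D + O(c ^ (1 + δ))` as `c ↓ 0`, uniformly for all
`f ∈ E⁻[0,1]` with `‖f‖_∞ ≤ 1`, where `‖·‖_D` is the `D`-norm generated by `Z`. -/
def UniformDeltaNeighborhood {Ω Ω' : Type*} [MeasurableSpace Ω] [MeasurableSpace Ω']
    (P : Measure Ω) (U : Ω → I → ℝ) (Q : Measure Ω') (Z : Ω' → C(I, ℝ)) (δ : ℝ) : Prop :=
  ∃ K > (0 : ℝ), ∃ c₀ > (0 : ℝ), ∀ f : I → ℝ, IsEMinus f → (∀ t, |f t| ≤ 1) →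
    ∀ c : ℝ, 0 < c → c < c₀ →
      |P.real {ω | ∀ t, U ω t ≤ 1 + c * f t} - (1 - c * functionalDNorm Q Z f)|
        ≤ K * c ^ (1 + δ)

/-- The marginal distribution function `F_t(x) = P(X_t ≤ x)` of a process. -/
def marginalCdf {Ω : Type*} [MeasurableSpace Ω] (P : Measure Ω) (X : Ω → C(I, ℝ)) (t : I)
    (x : ℝ) : ℝ :=
  cdf (P.map fun ω => X ω t) x

/-- The copula process `U_t = F_t(X_t)` pertaining to a process `X`. -/
def copulaProcess {Ω : Type*} [MeasurableSpace Ω] (P : Measure Ω) (X : Ω → C(I, ℝ))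
    (ω : Ω) (t : I) : ℝ :=
  marginalCdf P X t (X ω t)

/-- A grid `0 = t_1 < t_2 < ⋯ < t_d = 1` in `[0,1]`. -/
structure IsGrid {d : ℕ} (t : Fin d → I) : Prop where
  strictMono : StrictMono t
  zero_mem : 0 ∈ Set.range t
  one_mem : 1 ∈ Set.range t

/-- The mesh `max_{1 ≤ i ≤ d - 1} |t_{i+1} - t_i|` of a grid. -/
def gridMesh {d : ℕ} (t : Fin d → I) : ℝ :=
  ⨆ i : Fin (d - 1), |(t ⟨i + 1, by omega⟩ : ℝ) - (t ⟨i, by omega⟩ : ℝ)|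

/-- The generalized inverse `H⁻¹(q) = inf {x : H(x) ≥ q}`. -/
def genInv (H : ℝ → ℝ) (q : ℝ) : ℝ := sInf {x | q ≤ H x}

/-- The empirical distribution function of the observations `x 0, …, x (n - 1)`. -/
def empiricalCdf (n : ℕ) (x : ℕ → ℝ) (y : ℝ) : ℝ :=
  (((Finset.range n).filter fun i => x i ≤ y).card : ℝ) / n

open Classical in
/-- For the `d`-variate observations `x 0, …, x (n - 1)`: the number `n̂_{j,M}(c)` of those
observations with index in `M` which in at least one component `r` exceed the empirical marginal
quantile of order `1 - c / j` (computed from all `n` observations). -/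
def exceedanceCount (n : ℕ) (M : Finset ℕ) {d : ℕ} (x : ℕ → Fin d → ℝ) (c : ℝ) (j : ℕ) : ℕ :=
  (M.filter fun i => ∃ r, genInv (empiricalCdf n fun l => x l r) (1 - c / j) < x i r).card

/-- The average `k⁻¹ ∑_{ℓ=1}^k ℓ n̂_{ℓ,M}(c)`. -/
def avgExceedance (k n : ℕ) (M : Finset ℕ) {d : ℕ} (x : ℕ → Fin d → ℝ) (c : ℝ) : ℝ :=
  1 / (k : ℝ) * ∑ l ∈ Finset.Icc 1 k, (l : ℝ) * (exceedanceCount n M x c l : ℝ)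

/-- The test statistic `T̂_n(c)`. -/
def testStatistic (k n : ℕ) (M : Finset ℕ) {d : ℕ} (x : ℕ → Fin d → ℝ) (c : ℝ) : ℝ :=
  (∑ j ∈ Finset.Icc 1 k,
      ((j : ℝ) * (exceedanceCount n M x c j : ℝ) - avgExceedance k n M x c) ^ 2)
    / avgExceedance k n M x c

/-- The weights `λ_i = 1 / (4 sin² ((i / k) (π / 2)))`. -/
def limitWeight (k i : ℕ) : ℝ :=
  1 / (4 * Real.sin ((i : ℝ) / (k : ℝ) * (Real.pi / 2)) ^ 2)

end

/-! Suppose first that the marginals are known. Let `C_j` count the `i ∈ M(n)` whose copula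
transform exceeds `1 - c/j` at a grid point. The expansion, applied to `-1` times the indicator of
the grid, gives this event probability `(c/j) D_n + O(c^(1+δ))`, where the D-norm `D_n` of the
indicator stays in `[1, q]`. With `s_n = m_n c_n D_n`, every `j C_j` then has mean `s_n + O(m_n
c_n^(1+δ))`. The events decrease in `j`, so `j C_j` and `l C_l` have covariance about `j l s_n /
max(j,l) = min(j,l) s_n`: divided by `√s_n`, the centred counts behave like a Gaussian random walk
with `k` steps.

The statistic is the centred sum of squares of the `j C_j` over their average, and the average is
asymptotically `s_n`. The increments of the discrete sine basis diagonalize both structures at once.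
They sum to zero, which removes the unknown `s_n`, and with weights `λ_i` they resolve the centring
projection (`sum_limitWeight_mul_sq`). Their tail sums are orthonormal sines, so they turn the
covariance `min(j,l)` into the identity (`sum_sineIncrement_mul_min`). A triangular CLT by
characteristic functions (`tendstoInDistribution_sum_of_rowwise_iid`) and Slutsky's lemma then give
the limit in `tendstoInDistribution_count_statistic`.

Empirical quantiles cost little. Exchangeability bounds the chance that a fixed observation is
misclassified in one component by `(1 + √(n c)) / n` (`infinitePi_quantileDiscrepancy_le`). A union
bound over `m_n` observations and `d_n` components gives an `L¹` error that is `o(√s_n)` under the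
rate conditions. -/

/-! ### Empirical distribution functions and quantiles. -/

section EmpiricalQuantile

lemma empiricalCdf_mono (n : ℕ) (x : ℕ → ℝ) : Monotone (empiricalCdf n x) := by
  intro a b hab
  unfold empiricalCdf
  gcongr

lemma empiricalCdf_le_one (n : ℕ) (x : ℕ → ℝ) (y : ℝ) : empiricalCdf n x y ≤ 1 := by
  unfold empiricalCdf
  refine div_le_one_of_le₀ ?_ n.cast_nonneg
  exact_mod_cast (Finset.card_filter_le _ _).trans (Finset.card_range n).le

/-- Below any point of positive empirical mass there is an observation with the same mass. -/
lemma exists_obs_empiricalCdf_eq {n : ℕ} {x : ℕ → ℝ} {y : ℝ} (h : 0 < empiricalCdf n x y) :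
    ∃ i ∈ Finset.range n, x i ≤ y ∧ empiricalCdf n x (x i) = empiricalCdf n x y := by
  classical
  have hne : ((Finset.range n).filter fun i => x i ≤ y).Nonempty := by
    by_contra hcon
    rw [Finset.not_nonempty_iff_eq_empty] at hcon
    simp [empiricalCdf, hcon] at h
  obtain ⟨i, hi, hmax⟩ := Finset.exists_max_image _ x hne
  rw [Finset.mem_filter] at hi
  refine ⟨i, hi.1, hi.2, ?_⟩
  unfold empiricalCdf
  congr 3
  ext l
  simp only [Finset.mem_filter, and_congr_right_iff]
  exact fun hl => ⟨fun h' => h'.trans hi.2, fun h' => hmax l (by simp [Finset.mem_filter.2, h',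
    Finset.mem_range.1 hl])⟩

/-- The empirical cdf jumps only at observations, so the infimum is attained at the smallest
observation of mass at least `q`. Here `q ≤ 1` makes the level set nonempty and `0 < q` bounds it
below. -/
lemma isLeast_genInv_empiricalCdf {n : ℕ} (hn : 0 < n) (x : ℕ → ℝ) {q : ℝ} (hq : 0 < q)
    (hq1 : q ≤ 1) :
    IsLeast {y | q ≤ empiricalCdf n x y} (genInv (empiricalCdf n x) q) := by
  classical
  suffices h : ∃ a, IsLeast {y | q ≤ empiricalCdf n x y} a by
    obtain ⟨a, ha⟩ := h
    have : genInv (empiricalCdf n x) q = a := ha.csInf_eq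
    rwa [this]
  set V := (Finset.range n).filter fun i => q ≤ empiricalCdf n x (x i) with hV
  have hVne : V.Nonempty := by
    obtain ⟨i, hi, hmax⟩ := Finset.exists_max_image (Finset.range n) x ⟨0, by simpa using hn⟩
    refine ⟨i, Finset.mem_filter.2 ⟨hi, hq1.trans (le_of_eq ?_)⟩⟩
    unfold empiricalCdf
    rw [Finset.filter_true_of_mem hmax, Finset.card_range, div_self]
    exact_mod_cast hn.ne'
  obtain ⟨i, hi, hmin⟩ := Finset.exists_min_image V x hVne
  refine ⟨x i, (Finset.mem_filter.1 hi).2, fun y hy => ?_⟩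
  obtain ⟨l, hl, hly, hE⟩ := exists_obs_empiricalCdf_eq (hq.trans_le hy)
  exact (hmin l (Finset.mem_filter.2 ⟨hl, by rw [hE]; exact hy⟩)).trans hly

lemma genInv_empiricalCdf_le_iff {n : ℕ} (hn : 0 < n) (x : ℕ → ℝ) {q : ℝ} (hq : 0 < q)
    (hq1 : q ≤ 1) (y : ℝ) :
    genInv (empiricalCdf n x) q ≤ y ↔ q ≤ empiricalCdf n x y := by
  have h := isLeast_genInv_empiricalCdf hn x hq hq1
  exact ⟨fun hy => le_trans h.1 (empiricalCdf_mono n x hy), fun hy => h.2 hy⟩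

lemma measurable_empiricalCdf (n : ℕ) (y : ℝ) :
    Measurable fun x : ℕ → ℝ => empiricalCdf n x y := by
  unfold empiricalCdf
  simp_rw [Finset.card_filter, Nat.cast_sum]
  refine Measurable.div_const (Finset.measurable_sum _ fun i _ => ?_) _
  simp_rw [Nat.cast_ite]
  exact Measurable.ite (measurableSet_le (measurable_pi_apply i) measurable_const)
    measurable_const measurable_const

/-- Needed for every `q` and `n`, since `1 - c_n/j` may leave `(0,1]` for small `n`. In the
degenerate cases the level set does not depend on the sample, so the quantile is a constant default
value. -/
lemma measurable_genInv_empiricalCdf (n : ℕ) (q : ℝ) :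
    Measurable fun x : ℕ → ℝ => genInv (empiricalCdf n x) q := by
  rcases le_or_gt q 0 with hq | hq
  · have : ∀ x : ℕ → ℝ, genInv (empiricalCdf n x) q = sInf Set.univ := fun x => by
      unfold genInv
      congr 1
      ext y
      simp only [Set.mem_ofPred_eq, Set.mem_univ, iff_true]
      exact hq.trans (by unfold empiricalCdf; positivity)
    simp_rw [this]
    exact measurable_const
  rcases Nat.eq_zero_or_pos n with hn | hn
  · subst hn
    simp only [genInv, empiricalCdf, Finset.range_zero, Finset.filter_empty]
    exact measurable_const
  rcases le_or_gt q 1 with hq1 | hq1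
  · refine measurable_of_Iic fun y => ?_
    have : (fun x : ℕ → ℝ => genInv (empiricalCdf n x) q) ⁻¹' Set.Iic y
        = {x | q ≤ empiricalCdf n x y} := by
      ext x
      exact genInv_empiricalCdf_le_iff hn x hq hq1 y
    rw [this]
    exact measurableSet_le measurable_const (measurable_empiricalCdf n y)
  · have : ∀ x : ℕ → ℝ, genInv (empiricalCdf n x) q = sInf ∅ := fun x => by
      unfold genInv
      congr 1
      ext y
      simp only [Set.mem_ofPred_eq, Set.mem_empty_iff_false, iff_false, not_le]
      exact (empiricalCdf_le_one n x y).trans_lt hq1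
    simp_rw [this]
    exact measurable_const

lemma card_genInv_lt_eq (n : ℕ) (x : ℕ → ℝ) (a : ℝ) (hn : 0 < n) :
    (((Finset.range n).filter fun i => a < x i).card : ℝ) = n - n * empiricalCdf n x a := by
  have h := Finset.card_filter_add_card_filter_not (s := Finset.range n) (fun i => x i ≤ a)
  simp only [not_le, Finset.card_range] at h
  have hn' : (n : ℝ) ≠ 0 := by exact_mod_cast hn.ne'
  unfold empiricalCdf
  rw [mul_div_cancel₀ _ hn', eq_sub_iff_add_eq, add_comm]
  exact_mod_cast h

/-- Without ties, the number of observations above the empirical `q`-quantile is `n (1 - q)` up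
to one. -/
lemma abs_card_genInv_lt_sub_le {n : ℕ} (hn : 0 < n) {x : ℕ → ℝ} {q : ℝ} (hq : 0 < q)
    (hq1 : q ≤ 1) (hx : Set.InjOn x (Finset.range n)) :
    |(((Finset.range n).filter fun i => genInv (empiricalCdf n x) q < x i).card : ℝ)
      - n * (1 - q)| ≤ 1 := by
  classical
  set a := genInv (empiricalCdf n x) q with ha
  have hleast := isLeast_genInv_empiricalCdf hn x hq hq1
  have hn' : (0 : ℝ) < n := by exact_mod_cast hn
  rw [card_genInv_lt_eq n x a hn]
  have h1 : q ≤ empiricalCdf n x a := hleast.1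
  -- By minimality of `a`, the mass strictly below `a` is at most `q`; without ties the point `a`
  -- itself adds at most one observation.
  have h2 : n * empiricalCdf n x a ≤ n * q + 1 := by
    have hcard : ((Finset.range n).filter fun i => x i ≤ a).card
        ≤ ((Finset.range n).filter fun i => x i < a).card + 1 := by
      have hsub : ((Finset.range n).filter fun i => x i ≤ a)
          ⊆ ((Finset.range n).filter fun i => x i < a)
            ∪ ((Finset.range n).filter fun i => x i = a) := by
        intro i
        simp only [Finset.mem_filter, Finset.mem_union]
        rintro ⟨hi, h⟩
        rcases h.lt_or_eq with h | h <;> tauto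
      refine (Finset.card_le_card hsub).trans ((Finset.card_union_le _ _).trans ?_)
      gcongr
      rw [Finset.card_le_one]
      intro i hi l hl
      rw [Finset.mem_filter] at hi hl
      exact hx (by simpa using hi.1) (by simpa using hl.1) (hi.2.trans hl.2.symm)
    have hlt : (((Finset.range n).filter fun i => x i < a).card : ℝ) ≤ n * q := by
      rcases Finset.eq_empty_or_nonempty ((Finset.range n).filter fun i => x i < a) with h | h
      · rw [h]
        simp only [Finset.card_empty, Nat.cast_zero]
        positivity
      · obtain ⟨i, hi, hmax⟩ := Finset.exists_max_image _ x h
        rw [Finset.mem_filter] at hi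
        have : empiricalCdf n x (x i) < q := by
          by_contra hcon
          exact absurd (hleast.2 (not_lt.1 hcon)) (not_le.2 hi.2)
        have heq : ((Finset.range n).filter fun l => x l < a)
            ⊆ (Finset.range n).filter fun l => x l ≤ x i := by
          intro l hl
          rw [Finset.mem_filter]
          exact ⟨(Finset.mem_filter.1 hl).1, hmax l hl⟩
        calc (((Finset.range n).filter fun i => x i < a).card : ℝ)
            ≤ ((Finset.range n).filter fun l => x l ≤ x i).card := by
              exact_mod_cast Finset.card_le_card heq
          _ = n * empiricalCdf n x (x i) := by
              unfold empiricalCdf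
              field_simp
          _ ≤ n * q := by gcongr
    calc n * empiricalCdf n x a = ((Finset.range n).filter fun i => x i ≤ a).card := by
          unfold empiricalCdf
          field_simp
      _ ≤ ((Finset.range n).filter fun i => x i < a).card + 1 := by exact_mod_cast hcard
      _ ≤ n * q + 1 := by linarith
  have h3 : n * q ≤ n * empiricalCdf n x a := by gcongr
  rw [abs_le]
  constructor <;> linarith

/-- Symmetry of the empirical cdf in the sample, the source of exchangeability below. -/
lemma empiricalCdf_comp_perm {n : ℕ} (x : ℕ → ℝ) (τ : Equiv.Perm ℕ)
    (hτ : ∀ i, τ i ∈ Finset.range n ↔ i ∈ Finset.range n) (y : ℝ) :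
    empiricalCdf n (fun i => x (τ i)) y = empiricalCdf n x y := by
  classical
  unfold empiricalCdf
  congr 2
  refine Finset.card_bij (fun i _ => τ i) (fun i hi => ?_) (fun i _ l _ h => τ.injective h)
    (fun l hl => ⟨τ.symm l, ?_, by simp⟩)
  · rw [Finset.mem_filter] at hi ⊢
    exact ⟨(hτ i).2 hi.1, hi.2⟩
  · rw [Finset.mem_filter] at hl ⊢
    refine ⟨(hτ _).1 (by simpa using hl.1), by simpa using hl.2⟩

/-- For two upper sets, the number of sample points in the symmetric difference is the absolute
difference of the counts. -/
lemma card_not_iff_eq_abs_sub {s : Finset ℕ} {x : ℕ → ℝ} {p p' : ℝ → Prop} [DecidablePred p]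
    [DecidablePred p'] (hp : ∀ a b, a ≤ b → p a → p b) (hp' : ∀ a b, a ≤ b → p' a → p' b) :
    ((s.filter fun i => ¬(p (x i) ↔ p' (x i))).card : ℝ)
      = |((s.filter fun i => p (x i)).card : ℝ) - (s.filter fun i => p' (x i)).card| := by
  classical
  -- Upper sets of a linear order are nested.
  have hcases : (∀ a, p a → p' a) ∨ (∀ a, p' a → p a) := by
    by_contra hcon
    push Not at hcon
    obtain ⟨⟨a, ha, ha'⟩, b, hb, hb'⟩ := hcon
    rcases le_total a b with hab | hab
    · exact hb' (hp a b hab ha)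
    · exact ha' (hp' b a hab hb)
  have key : ∀ u v : ℝ → Prop, (∀ a, u a → v a) →
      ((s.filter fun i => ¬(u (x i) ↔ v (x i))).card : ℝ)
        = ((s.filter fun i => v (x i)).card : ℝ) - (s.filter fun i => u (x i)).card := by
    intro u v huv
    have h1 : (s.filter fun i => ¬(u (x i) ↔ v (x i)))
        = (s.filter fun i => v (x i)) \ (s.filter fun i => u (x i)) := by
      ext i
      simp only [Finset.mem_filter, Finset.mem_sdiff]
      have := huv (x i)
      tauto
    have hsub : (s.filter fun i => u (x i)) ⊆ (s.filter fun i => v (x i)) := by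
      intro i
      simp only [Finset.mem_filter]
      exact fun h => ⟨h.1, huv _ h.2⟩
    rw [h1, Finset.card_sdiff_of_subset hsub, Nat.cast_sub (Finset.card_le_card hsub)]
  rcases hcases with h | h
  · have := key p p' h
    rw [abs_sub_comm, abs_of_nonneg]
    · convert this
    · rw [sub_nonneg]
      exact_mod_cast Finset.card_le_card fun i hi => by
        rw [Finset.mem_filter] at hi ⊢
        exact ⟨hi.1, h _ hi.2⟩
  · have := key p' p h
    rw [abs_of_nonneg]
    · have h2 : (s.filter fun i => ¬(p (x i) ↔ p' (x i)))
          = s.filter fun i => ¬(p' (x i) ↔ p (x i)) :=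
        Finset.filter_congr fun i _ => not_congr Iff.comm
      rw [h2]
      convert this
    · rw [sub_nonneg]
      exact_mod_cast Finset.card_le_card fun i hi => by
        rw [Finset.mem_filter] at hi ⊢
        exact ⟨hi.1, h _ hi.2⟩

end EmpiricalQuantile

/-! ### Binomial counts and misclassification by empirical quantiles. -/

section IidCounts

variable {Ω : Type*} [MeasurableSpace Ω] {P : Measure Ω} [IsProbabilityMeasure P]

lemma integral_abs_le_sqrt_integral_sq {f : Ω → ℝ} (hf : MemLp f 2 P) :
    ∫ ω, |f ω| ∂P ≤ √(∫ ω, f ω ^ 2 ∂P) := by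
  have h := variance_nonneg |f| P
  rw [variance_eq_sub hf.abs] at h
  refine Real.le_sqrt_of_sq_le ?_
  simpa using h

lemma memLp_indicator_comp {𝓧 : Type*} [MeasurableSpace 𝓧] {y : Ω → 𝓧} (hy : Measurable y)
    {B : Set 𝓧} (hB : MeasurableSet B) :
    MemLp (fun ω => B.indicator (1 : 𝓧 → ℝ) (y ω)) 2 P := by
  refine MemLp.of_bound ?_ 1 (Eventually.of_forall fun ω => ?_)
  · exact ((measurable_one.indicator hB).comp hy).aestronglyMeasurable
  · by_cases h : y ω ∈ B <;> simp [h]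

lemma integral_indicator_comp {𝓧 : Type*} [MeasurableSpace 𝓧] {y : Ω → 𝓧} (hy : Measurable y)
    {B : Set 𝓧} (hB : MeasurableSet B) :
    ∫ ω, B.indicator (1 : 𝓧 → ℝ) (y ω) ∂P = P.real (y ⁻¹' B) := by
  rw [← integral_indicator_one (hy hB)]
  rfl

/-- The number of points of an i.i.d. sample in a set of probability `p` deviates from its mean
by at most `√(m p)` in `L¹`. -/
lemma integral_abs_sum_indicator_sub_le {𝓧 : Type*} [MeasurableSpace 𝓧] {y : ℕ → Ω → 𝓧}
    (hy : ∀ i, Measurable (y i)) (hind : iIndepFun y P) {B : Set 𝓧} (hB : MeasurableSet B)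
    {p : ℝ} (hp : ∀ i, P.real (y i ⁻¹' B) = p) (s : Finset ℕ) :
    ∫ ω, |∑ i ∈ s, B.indicator (1 : 𝓧 → ℝ) (y i ω) - s.card * p| ∂P ≤ √(s.card * p) := by
  set f : ℕ → Ω → ℝ := fun i ω => B.indicator (1 : 𝓧 → ℝ) (y i ω) with hf
  have hfL : ∀ i, MemLp (f i) 2 P := fun i => memLp_indicator_comp (hy i) hB
  have hfint : ∀ i, ∫ ω, f i ω ∂P = p := fun i => by
    rw [← hp i]
    exact integral_indicator_comp (hy i) hB
  have hsum : MemLp (∑ i ∈ s, f i) 2 P := memLp_finsetSum' s fun i _ => hfL i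
  have hmean : ∫ ω, (∑ i ∈ s, f i) ω ∂P = s.card * p := by
    simp only [Finset.sum_apply]
    rw [integral_finsetSum _ fun i _ => (hfL i).integrable one_le_two]
    simp [hfint]
  have hindf : iIndepFun f P :=
    hind.comp (fun _ => B.indicator (1 : 𝓧 → ℝ)) fun _ => measurable_one.indicator hB
  have hvar : ∫ ω, ((∑ i ∈ s, f i) ω - s.card * p) ^ 2 ∂P ≤ s.card * p := by
    have h := variance_eq_integral (μ := P) hsum.aestronglyMeasurable.aemeasurable
    rw [hmean] at h
    rw [← h, IndepFun.variance_sum (fun i _ => hfL i)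
      fun i _ j _ hij => hindf.indepFun hij]
    calc ∑ i ∈ s, Var[f i; P] ≤ ∑ i ∈ s, p := by
          refine Finset.sum_le_sum fun i _ => ?_
          refine (variance_le_expectation_sq (hfL i).aestronglyMeasurable).trans (le_of_eq ?_)
          rw [← hfint i]
          congr 1
          ext ω
          by_cases h : y i ω ∈ B <;> simp [hf, h]
      _ = s.card * p := by simp
  have hL : MemLp (fun ω => (∑ i ∈ s, f i) ω - s.card * p) 2 P := hsum.sub (memLp_const _)
  have := (integral_abs_le_sqrt_integral_sq hL).trans (Real.sqrt_le_sqrt hvar)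
  simpa only [Finset.sum_apply] using this

lemma nonatomic_of_continuous_cdf {μ : Measure ℝ} [IsProbabilityMeasure μ]
    (h : Continuous (cdf μ)) (a : ℝ) : μ {a} = 0 := by
  rw [← measure_cdf μ, StieltjesFunction.measure_singleton,
    h.continuousAt.continuousWithinAt.leftLim_eq (α := ℝ)]
  simp

/-- The probability integral transform. The cdf may have flat pieces, so `{cdf ≤ q}` is squeezed
between half-lines `Iic a` with `cdf a = q` and with `cdf a = r` for `r > q`, using that a
continuous cdf attains every value in `(0,1)`. -/
lemma measureReal_lt_cdf {μ : Measure ℝ} [IsProbabilityMeasure μ]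
    (h : Continuous (cdf μ)) {q : ℝ} (hq : 0 < q) (hq1 : q < 1) :
    μ.real {y | q < cdf μ y} = 1 - q := by
  have hsurj : ∀ r, 0 < r → r < 1 → ∃ a, cdf μ a = r := fun r hr hr1 =>
    mem_range_of_exists_le_of_exists_ge h
      (((tendsto_cdf_atBot μ).eventually_lt_const hr).exists.imp fun _ h => h.le)
      (((tendsto_cdf_atTop μ).eventually_const_lt hr1).exists.imp fun _ h => h.le)
  have hmeas : MeasurableSet {y | cdf μ y ≤ q} := measurableSet_le h.measurable measurable_const
  have hle : μ.real {y | cdf μ y ≤ q} = q := by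
    apply le_antisymm
    · refine le_of_forall_gt_imp_ge_of_dense fun r hr => ?_
      rcases lt_or_ge r 1 with hr1 | hr1
      · obtain ⟨a, ha⟩ := hsurj r (hq.trans hr) hr1
        rw [← ha, cdf_eq_real]
        refine measureReal_mono fun y hy => ?_
        by_contra hcon
        have := monotone_cdf μ (not_le.1 hcon).le
        rw [ha] at this
        exact absurd (this.trans hy) (not_le.2 hr)
      · exact measureReal_le_one.trans hr1
    · obtain ⟨a, ha⟩ := hsurj q hq hq1
      nth_rw 1 [← ha]
      rw [cdf_eq_real]
      refine measureReal_mono fun y hy => ?_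
      have := monotone_cdf μ (Set.mem_Iic.1 hy)
      rwa [ha] at this
  have : {y | q < cdf μ y} = {y | cdf μ y ≤ q}ᶜ := by
    ext y
    simp
  rw [this, probReal_compl_eq_one_sub hmeas, hle]

/-- The observation with index `i` is classified differently by the empirical and by the true
marginal quantile of order `q`. -/
def quantileDiscrepancy (n : ℕ) (F : ℝ → ℝ) (q : ℝ) (i : ℕ) : Set (ℕ → ℝ) :=
  {x | ¬(genInv (empiricalCdf n x) q < x i ↔ q < F (x i))}

lemma measurableSet_quantileDiscrepancy (n : ℕ) {F : ℝ → ℝ} (hF : Measurable F) (q : ℝ) (i : ℕ) :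
    MeasurableSet (quantileDiscrepancy n F q i) := by
  have h1 : MeasurableSet {x : ℕ → ℝ | genInv (empiricalCdf n x) q < x i} :=
    measurableSet_lt (measurable_genInv_empiricalCdf n q) (measurable_pi_apply i)
  have h2 : MeasurableSet {x : ℕ → ℝ | q < F (x i)} :=
    measurableSet_lt measurable_const (hF.comp (measurable_pi_apply i))
  exact (h1.iff h2).compl

/-- Both indices lie in the sample, so the swap leaves the empirical quantile unchanged and only
moves the tested observation. -/
lemma quantileDiscrepancy_comp_swap {n : ℕ} (F : ℝ → ℝ) (q : ℝ) {i l : ℕ} (hi : i < n)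
    (hl : l < n) :
    (fun (x : ℕ → ℝ) m => x (Equiv.swap i l m)) ⁻¹' quantileDiscrepancy n F q i
      = quantileDiscrepancy n F q l := by
  ext x
  have : empiricalCdf n (fun m => x (Equiv.swap i l m)) = empiricalCdf n x := by
    ext y
    refine empiricalCdf_comp_perm x (Equiv.swap i l) (fun m => ?_) y
    rw [Finset.mem_range, Finset.mem_range, Equiv.swap_apply_def]
    split_ifs <;> simp_all
  simp only [quantileDiscrepancy, Set.mem_preimage, Set.mem_ofPred_eq, this,
    Equiv.swap_apply_left]

/-- By Fubini the diagonal is null for the product of a nonatomic law with itself; there are only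
countably many pairs of indices. -/
lemma ae_injective_infinitePi {μ : Measure ℝ} [IsProbabilityMeasure μ] (h : ∀ a, μ {a} = 0) :
    ∀ᵐ x ∂(Measure.infinitePi fun _ : ℕ => μ), Function.Injective x := by
  have key : ∀ i l : ℕ, i ≠ l → ∀ᵐ x ∂(Measure.infinitePi fun _ : ℕ => μ), x i ≠ x l := by
    intro i l hil
    have hd : MeasurableSet {z : ℝ × ℝ | z.1 = z.2} :=
      measurableSet_eq_fun measurable_fst measurable_snd
    have h0 : (μ.prod μ) {z : ℝ × ℝ | z.1 = z.2} = 0 := by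
      rw [Measure.measure_prod_null hd]
      refine Eventually.of_forall fun a => ?_
      have : (Prod.mk a ⁻¹' {z : ℝ × ℝ | z.1 = z.2}) = {a} := by
        ext b
        simp [eq_comm]
      simp only [this, h, Pi.zero_apply]
    rw [← Measure.infinitePi_map_eval_prod (P := fun _ : ℕ => μ) hil,
      Measure.map_apply (by fun_prop) hd] at h0
    rw [ae_iff]
    simpa using h0
  have : ∀ᵐ x ∂(Measure.infinitePi fun _ : ℕ => μ), ∀ i l : ℕ, i ≠ l → x i ≠ x l := by
    rw [ae_all_iff]
    intro i
    rw [ae_all_iff]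
    intro l
    by_cases hil : i = l
    · exact Eventually.of_forall fun x hx => absurd hil hx
    · filter_upwards [key i l hil] with x hx _ using hx
  filter_upwards [this] with x hx i l hil
  by_contra hcon
  exact hx i l hcon hil

/-- In a sample of size `n` from a continuous distribution, a given observation is classified
differently by the empirical and the true `q`-quantile with probability at most
`(1 + √(n (1 - q))) / n`. -/
lemma infinitePi_quantileDiscrepancy_le {μ : Measure ℝ} [IsProbabilityMeasure μ]
    (h : Continuous (cdf μ)) {q : ℝ} (hq : 0 < q) (hq1 : q < 1) {n i : ℕ} (hi : i < n) :
    (Measure.infinitePi fun _ : ℕ => μ).real (quantileDiscrepancy n (cdf μ) q i)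
      ≤ (1 + √(n * (1 - q))) / n := by
  classical
  set ν := Measure.infinitePi fun _ : ℕ => μ with hν
  have hn : 0 < n := by omega
  have hn' : (0 : ℝ) < n := by exact_mod_cast hn
  have hmeas := measurableSet_quantileDiscrepancy n h.measurable q
  have hB : MeasurableSet {y | q < cdf μ y} := measurableSet_lt measurable_const h.measurable
  have hindep : iIndepFun (fun (i : ℕ) (x : ℕ → ℝ) => x i) ν :=
    iIndepFun_infinitePi (X := fun _ x => x) fun _ => measurable_id
  have hp : ∀ i : ℕ, ν.real ((fun x : ℕ → ℝ => x i) ⁻¹' {y | q < cdf μ y}) = 1 - q := by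
    intro i
    rw [← map_measureReal_apply (measurable_pi_apply i) hB, hν, Measure.infinitePi_map_eval]
    exact measureReal_lt_cdf h hq hq1
  have heq : ∀ l < n, ν.real (quantileDiscrepancy n (cdf μ) q l)
      = ν.real (quantileDiscrepancy n (cdf μ) q i) := by
    intro l hl
    have hmap : ν.map (fun x m => x (Equiv.swap i l m)) = ν :=
      Measure.map_infinitePi_infinitePi_of_inj (P := fun _ : ℕ => μ) (Equiv.swap i l).injective
    rw [← quantileDiscrepancy_comp_swap (cdf μ) q hi hl,
      ← map_measureReal_apply (by fun_prop) (hmeas i), hmap]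
  set N : (ℕ → ℝ) → ℝ := fun x =>
    ∑ l ∈ Finset.range n, {y | q < cdf μ y}.indicator (1 : ℝ → ℝ) (x l) with hN
  have hNL : Integrable (fun x => |N x - n * (1 - q)|) ν := by
    refine (Integrable.sub ?_ (integrable_const _)).abs
    exact integrable_finsetSum _ fun l _ =>
      (memLp_indicator_comp (measurable_pi_apply l) hB).integrable one_le_two
  -- By exchangeability, `n` times one probability is the expected number of misclassified
  -- observations in the whole sample.
  have hsum : n * ν.real (quantileDiscrepancy n (cdf μ) q i)
      = ∫ x, ∑ l ∈ Finset.range n, (quantileDiscrepancy n (cdf μ) q l).indicator 1 x ∂ν := by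
    rw [integral_finsetSum (Finset.range n)
      (f := fun l x => (quantileDiscrepancy n (cdf μ) q l).indicator (1 : (ℕ → ℝ) → ℝ) x)
      fun l _ => (integrable_const (1 : ℝ)).indicator (hmeas l)]
    simp_rw [integral_indicator_one (hmeas _)]
    rw [Finset.sum_congr rfl fun l hl => heq l (Finset.mem_range.1 hl)]
    simp
  -- Off ties, the number of misclassified observations is the difference of the counts above the
  -- two quantiles. The empirical count is within `1` of `n (1 - q)`; the true count is binomial and
  -- deviates from it by at most `√(n (1 - q))` in `L¹`.
  have hbound : n * ν.real (quantileDiscrepancy n (cdf μ) q i) ≤ 1 + √(n * (1 - q)) := by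
    rw [hsum]
    calc ∫ x, ∑ l ∈ Finset.range n, (quantileDiscrepancy n (cdf μ) q l).indicator 1 x ∂ν
        ≤ ∫ x, (1 + |N x - n * (1 - q)|) ∂ν := by
          refine integral_mono_ae (integrable_finsetSum _ fun l _ =>
            (integrable_const (1 : ℝ)).indicator (hmeas l)) ((integrable_const _).add hNL) ?_
          filter_upwards [ae_injective_infinitePi (nonatomic_of_continuous_cdf h)] with x hx
          have hQ := abs_card_genInv_lt_sub_le hn hq hq1.le (hx.injOn (s := Finset.range n))
          have hcard := card_not_iff_eq_abs_sub (s := Finset.range n) (x := x)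
            (p := fun y => genInv (empiricalCdf n x) q < y) (p' := fun y => q < cdf μ y)
            (fun a b hab ha => ha.trans_le hab) (fun a b hab ha => ha.trans_le (monotone_cdf μ hab))
          have hNx : N x = ((Finset.range n).filter fun l => q < cdf μ (x l)).card := by
            rw [hN, ← Finset.sum_boole]
            exact Finset.sum_congr rfl fun l _ => by simp [Set.indicator_apply]
          have hS : ∑ l ∈ Finset.range n,
              (quantileDiscrepancy n (cdf μ) q l).indicator (1 : (ℕ → ℝ) → ℝ) x
              = ((Finset.range n).filter fun l =>
                ¬(genInv (empiricalCdf n x) q < x l ↔ q < cdf μ (x l))).card := by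
            rw [← Finset.sum_boole]
            refine Finset.sum_congr rfl fun l _ => ?_
            rw [Set.indicator_apply]
            exact if_congr Iff.rfl rfl rfl
          simp only [hS, hcard, hNx]
          refine (abs_sub_le _ (n * (1 - q)) _).trans ?_
          rw [abs_sub_comm (n * (1 - q))]
          gcongr
      _ = 1 + ∫ x, |N x - n * (1 - q)| ∂ν := by
          rw [integral_add (integrable_const _) hNL]
          simp
      _ ≤ 1 + √(n * (1 - q)) := by
          gcongr
          simpa using integral_abs_sum_indicator_sub_le (fun i => measurable_pi_apply i) hindep
            hB hp (Finset.range n)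
  rw [le_div_iff₀ hn', mul_comm]
  exact hbound

lemma measureReal_quantileDiscrepancy_le {x : ℕ → Ω → ℝ} (hx : ∀ i, Measurable (x i))
    (hind : iIndepFun x P) {μ : Measure ℝ} [IsProbabilityMeasure μ]
    (hlaw : ∀ i, P.map (x i) = μ) (h : Continuous (cdf μ)) {q : ℝ} (hq : 0 < q) (hq1 : q < 1)
    {n i : ℕ} (hi : i < n) :
    P.real {ω | ¬(genInv (empiricalCdf n fun l => x l ω) q < x i ω ↔ q < cdf μ (x i ω))}
      ≤ (1 + √(n * (1 - q))) / n := by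
  have hmap : P.map (fun ω i => x i ω) = Measure.infinitePi fun _ : ℕ => μ := by
    rw [hind.map_fun_eq_infinitePi_map hx]
    simp_rw [hlaw]
  have := infinitePi_quantileDiscrepancy_le h hq hq1 hi
  rw [← hmap, map_measureReal_apply (by fun_prop)
    (measurableSet_quantileDiscrepancy n h.measurable q i)] at this
  exact this

end IidCounts

/-! ### Central limit theorem for triangular arrays. -/

section TriangularCLT

open scoped RealInnerProductSpace

/-- `(1 + g)^m → exp t` if `m → ∞` and `m g → t`. -/
lemma tendsto_one_add_pow_exp_of_tendsto_mul {m : ℕ → ℕ} {g : ℕ → ℂ} {t : ℂ}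
    (hm : Tendsto m atTop atTop) (hg : Tendsto (fun n => (m n : ℂ) * g n) atTop (𝓝 t)) :
    Tendsto (fun n => (1 + g n) ^ m n) atTop (𝓝 (Complex.exp t)) := by
  have hminv : Tendsto (fun n => ((m n : ℂ))⁻¹) atTop (𝓝 0) :=
    (tendsto_inv_atTop_nhds_zero_nat (𝕜 := ℂ)).comp hm
  have hmpos : ∀ᶠ n in atTop, (m n : ℂ) ≠ 0 := by
    filter_upwards [hm.eventually_gt_atTop 0] with n hn
    exact_mod_cast hn.ne'
  have hg0 : Tendsto g atTop (𝓝 0) := by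
    have := hminv.mul hg
    rw [zero_mul] at this
    refine this.congr' ?_
    filter_upwards [hmpos] with n hn
    field_simp
  have hlittle : (fun n => Complex.log (1 + g n) - g n) =o[atTop] g := by
    have h := (Complex.hasDerivAt_log (z := 1) (by simp)).isLittleO
    have h2 : Tendsto (fun n => 1 + g n) atTop (𝓝 1) := by simpa using hg0.const_add 1
    have h3 := h.comp_tendsto h2
    simpa [Function.comp_def] using h3
  have hrem : Tendsto (fun n => (m n : ℂ) * (Complex.log (1 + g n) - g n)) atTop (𝓝 0) := by
    have h1 : (fun n => (m n : ℂ) * (Complex.log (1 + g n) - g n))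
        =o[atTop] fun n => (m n : ℂ) * g n :=
      (Asymptotics.isBigO_refl _ _).mul_isLittleO hlittle
    have h2 : (fun n => (m n : ℂ) * g n) =O[atTop] fun _ => (1 : ℝ) := hg.isBigO_one ℝ
    exact (h1.trans_isBigO h2).tendsto_zero_of_tendsto tendsto_const_nhds
  have hlog : Tendsto (fun n => (m n : ℂ) * Complex.log (1 + g n)) atTop (𝓝 t) := by
    have := hg.add hrem
    rw [add_zero] at this
    refine this.congr fun n => ?_
    ring
  refine ((Complex.continuous_exp.tendsto t).comp hlog).congr' ?_
  have hne : ∀ᶠ n in atTop, 1 + g n ≠ 0 := by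
    have h2 : Tendsto (fun n => 1 + g n) atTop (𝓝 1) := by simpa using hg0.const_add 1
    exact h2.eventually_ne one_ne_zero
  filter_upwards [hne] with n hn
  rw [Function.comp_apply, Complex.exp_nat_mul, Complex.exp_log hn]

lemma norm_exp_mul_I_sub_le {x : ℝ} (hx : |x| ≤ 1) :
    ‖Complex.exp (x * Complex.I) - (1 + x * Complex.I - (x : ℂ) ^ 2 / 2)‖ ≤ |x| ^ 3 := by
  have hn : ‖(x * Complex.I : ℂ)‖ = |x| := by simp
  have h := Complex.exp_bound (x := x * Complex.I) (by rw [hn]; exact hx) (n := 3) (by norm_num)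
  rw [hn] at h
  have hsum : ∑ m ∈ Finset.range 3, (x * Complex.I : ℂ) ^ m / (m.factorial : ℂ)
      = 1 + x * Complex.I - (x : ℂ) ^ 2 / 2 := by
    simp only [Finset.sum_range_succ, Finset.sum_range_zero, Nat.factorial]
    push_cast
    simp only [mul_pow, Complex.I_sq]
    ring
  rw [hsum] at h
  refine h.trans ?_
  have : ((Nat.succ 3 : ℕ) * ((Nat.factorial 3 : ℕ) * (3 : ℕ) : ℝ)⁻¹ : ℝ) ≤ 1 := by
    norm_num [Nat.factorial]
  exact mul_le_of_le_one_right (by positivity) this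

variable {Ω : Type*} [MeasurableSpace Ω] {P : Measure Ω} [IsProbabilityMeasure P]
  {Ω' : Type*} [MeasurableSpace Ω'] {P' : Measure Ω'} [IsProbabilityMeasure P']

/-- Centring kills the linear Taylor term, and `|X|³ ≤ b X²` makes the remainder smaller than the
variance by the factor `b`. -/
lemma norm_integral_exp_mul_I_sub_le {X : Ω → ℝ} (hX : Measurable X) {b : ℝ}
    (hb : ∀ ω, |X ω| ≤ b) (hb1 : b ≤ 1) (h0 : ∫ ω, X ω ∂P = 0) :
    ‖∫ ω, Complex.exp (X ω * Complex.I) ∂P - (1 - ((∫ ω, X ω ^ 2 ∂P : ℝ) : ℂ) / 2)‖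
      ≤ b * ∫ ω, X ω ^ 2 ∂P := by
  have hXi : Integrable X P :=
    (MemLp.of_bound (p := 1) hX.aestronglyMeasurable b (Eventually.of_forall hb)).integrable le_rfl
  have hX2 : Integrable (fun ω => X ω ^ 2) P := by
    refine (MemLp.of_bound (p := 1) (hX.pow_const 2).aestronglyMeasurable (b ^ 2)
      (Eventually.of_forall fun ω => ?_)).integrable le_rfl
    rw [norm_pow]
    exact pow_le_pow_left₀ (norm_nonneg _) (hb ω) 2
  have hE : Integrable (fun ω => Complex.exp (X ω * Complex.I)) P := by
    refine (MemLp.of_bound (p := 1) (by fun_prop) 1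
      (Eventually.of_forall fun ω => ?_)).integrable le_rfl
    rw [Complex.norm_exp_ofReal_mul_I]
  have hXc : Integrable (fun ω => (X ω : ℂ) * Complex.I) P := hXi.ofReal.mul_const _
  have hX2c : Integrable (fun ω => (X ω : ℂ) ^ 2 / 2) P := by
    have := (hX2.ofReal (𝕜 := ℂ)).div_const 2
    simpa using this
  have heq : ∫ ω, Complex.exp (X ω * Complex.I) ∂P - (1 - ((∫ ω, X ω ^ 2 ∂P : ℝ) : ℂ) / 2)
      = ∫ ω, (Complex.exp (X ω * Complex.I) - (1 + X ω * Complex.I - (X ω : ℂ) ^ 2 / 2)) ∂P := by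
    have h1 : Integrable (fun ω => 1 + (X ω : ℂ) * Complex.I) P := (integrable_const _).add hXc
    have h2 : Integrable (fun ω => 1 + (X ω : ℂ) * Complex.I - (X ω : ℂ) ^ 2 / 2) P := h1.sub hX2c
    rw [integral_sub hE h2,
      integral_sub h1 hX2c, integral_add (integrable_const _) hXc,
      integral_mul_const, integral_div, integral_complex_ofReal, h0]
    have : ∫ ω, (X ω : ℂ) ^ 2 ∂P = ((∫ ω, X ω ^ 2 ∂P : ℝ) : ℂ) := by
      rw [← integral_complex_ofReal]
      simp
    rw [this]
    simp
  rw [heq, ← integral_const_mul]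
  refine norm_integral_le_of_norm_le (hX2.const_mul b) (Eventually.of_forall fun ω => ?_)
  refine (norm_exp_mul_I_sub_le ((hb ω).trans hb1)).trans ?_
  calc |X ω| ^ 3 = |X ω| * X ω ^ 2 := by rw [← sq_abs (X ω)]; ring
    _ ≤ b * X ω ^ 2 := by gcongr; exact hb ω

variable {E : Type*} [NormedAddCommGroup E] [InnerProductSpace ℝ E] [FiniteDimensional ℝ E]
  [MeasurableSpace E] [BorelSpace E]

/-- Central limit theorem for triangular arrays of uniformly small, rowwise i.i.d. centred random
vectors whose covariance converges to the identity. -/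
theorem tendstoInDistribution_sum_of_rowwise_iid {G : ℕ → ℕ → Ω → E}
    (hG : ∀ n i, Measurable (G n i)) (hind : ∀ n, iIndepFun (G n) P)
    (hid : ∀ n i, P.map (G n i) = P.map (G n 0))
    {b : ℕ → ℝ} (hb : Tendsto b atTop (𝓝 0)) (hGb : ∀ᶠ n in atTop, ∀ ω, ‖G n 0 ω‖ ≤ b n)
    (hmean : ∀ n θ, ∫ ω, ⟪G n 0 ω, θ⟫ ∂P = 0)
    {M : ℕ → Finset ℕ} (hM : Tendsto (fun n => (M n).card) atTop atTop)
    (hvar : ∀ θ, Tendsto (fun n => ((M n).card : ℝ) * ∫ ω, ⟪G n 0 ω, θ⟫ ^ 2 ∂P) atTop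
      (𝓝 (‖θ‖ ^ 2)))
    {ξ : Ω' → E} (hξ : AEMeasurable ξ P')
    (hξc : ∀ θ, charFun (P'.map ξ) θ = Complex.exp (-(‖θ‖ : ℂ) ^ 2 / 2)) :
    TendstoInDistribution (fun n ω => ∑ i ∈ M n, G n i ω) atTop ξ (fun _ => P) P' where
  forall_aemeasurable n := (Finset.measurable_sum _ fun i _ => hG n i).aemeasurable
  aemeasurable_limit := hξ
  tendsto := by
    refine ProbabilityMeasure.tendsto_iff_tendsto_charFun.2 fun θ => ?_
    simp only [ProbabilityMeasure.coe_mk]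
    rw [hξc θ]
    set φ : ℕ → ℂ := fun n => charFun (P.map (G n 0)) θ with hφ
    have hchar : ∀ n, charFun (P.map fun ω => ∑ i ∈ M n, G n i ω) θ
        = (1 + (φ n - 1)) ^ (M n).card := by
      intro n
      rw [((hind n).restrict (M n)).charFun_map_fun_finsetSum_eq_prod
        fun i _ => (hG n i).aemeasurable]
      simp [hid n, hφ]
    simp_rw [hchar]
    -- It remains to see that `m (φ - 1) → -‖θ‖²/2`.
    refine tendsto_one_add_pow_exp_of_tendsto_mul hM ?_
    set v : ℕ → ℝ := fun n => ∫ ω, ⟪G n 0 ω, θ⟫ ^ 2 ∂P with hv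
    have hφe : ∀ n, φ n = ∫ ω, Complex.exp ((⟪G n 0 ω, θ⟫ : ℝ) * Complex.I) ∂P := by
      intro n
      rw [hφ]
      simp only [charFun_apply]
      rw [integral_map (hG n 0).aemeasurable (by fun_prop)]
    have hbθ : Tendsto (fun n => b n * ‖θ‖) atTop (𝓝 0) := by
      simpa using hb.mul_const ‖θ‖
    have hmv := hvar θ
    -- The Taylor error is at most `b ‖θ‖` times `m v`, where `b → 0` and `m v` converges.
    have herr : Tendsto (fun n => ((M n).card : ℂ) * (φ n - (1 - (v n : ℂ) / 2))) atTop (𝓝 0) := by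
      have hlim : Tendsto (fun n => b n * ‖θ‖ * (((M n).card : ℝ) * v n)) atTop (𝓝 0) := by
        simpa using hbθ.mul hmv
      refine squeeze_zero_norm' ?_ hlim
      filter_upwards [hGb, hbθ.eventually_le_const one_pos] with n hn hn1
      have hbd : ∀ ω, |⟪G n 0 ω, θ⟫| ≤ b n * ‖θ‖ := fun ω =>
        (abs_real_inner_le_norm _ _).trans (by gcongr; exact hn ω)
      have h := norm_integral_exp_mul_I_sub_le (P := P) (X := fun ω => ⟪G n 0 ω, θ⟫)
        ((hG n 0).inner_const) hbd hn1 (hmean n θ)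
      rw [norm_mul, hφe n, Complex.norm_natCast]
      calc ((M n).card : ℝ) * _ ≤ (M n).card * (b n * ‖θ‖ * v n) := by gcongr
        _ = _ := by ring
    have hmain : Tendsto (fun n => -((((M n).card : ℝ) * v n : ℝ) : ℂ) / 2) atTop
        (𝓝 (-((‖θ‖ ^ 2 : ℝ) : ℂ) / 2)) :=
      (((Complex.continuous_ofReal.tendsto _).comp hmv).neg).div_const 2
    have := hmain.add herr
    rw [add_zero] at this
    convert this using 2 with n
    · push_cast
      ring
    · push_cast
      rfl

end TriangularCLT

/-! ### Discrete sine and cosine bases. -/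

section CosineBasis

open Real

/-- Multiplied by `2 sin (x/2)`, the sum telescopes as for the Dirichlet kernel. -/
lemma sum_cos_mul_eq {k : ℕ} {x : ℝ} (hx : sin (x / 2) ≠ 0) (hk : sin (k * x) = 0) :
    ∑ i ∈ Finset.range k, cos (i * x) = (1 - cos (k * x)) / 2 := by
  have h : ∀ n : ℕ, 2 * sin (x / 2) * ∑ i ∈ Finset.range n, cos (i * x)
      = sin (n * x - x / 2) + sin (x / 2) := by
    intro n
    induction n with
    | zero => simp
    | succ n ih =>
      rw [Finset.sum_range_succ, mul_add, ih]
      have h1 : sin (((n + 1 : ℕ) : ℝ) * x - x / 2)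
          = sin (n * x) * cos (x / 2) + cos (n * x) * sin (x / 2) := by
        rw [← sin_add]
        congr 1
        push_cast
        ring
      rw [h1, sin_sub]
      ring
  have h2 := h k
  rw [sin_sub, hk] at h2
  have h3 : 2 * sin (x / 2) * (∑ i ∈ Finset.range k, cos (i * x) - (1 - cos (k * x)) / 2) = 0 := by
    linear_combination h2
  rcases mul_eq_zero.1 h3 with h4 | h4
  · exact absurd h4 (mul_ne_zero two_ne_zero hx)
  · linarith

/-- The cosine sum over one half period. -/
lemma sum_cos_int_mul_pi_div {k : ℕ} {p : ℤ} (hp0 : p ≠ 0) (hp1 : |p| < 2 * k) :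
    ∑ i ∈ Finset.range k, cos (i * (p * π / k)) = (1 - cos (p * π)) / 2 := by
  have hk : (k : ℝ) ≠ 0 := by
    rintro h
    have : (k : ℤ) = 0 := by exact_mod_cast h
    rw [this] at hp1
    exact absurd hp1 (by simp)
  have hkp : (k : ℝ) * (p * π / k) = p * π := by field_simp
  have := sum_cos_mul_eq (k := k) (x := p * π / k) ?_ ?_
  · rw [this, hkp]
  · intro h
    rw [sin_eq_zero_iff] at h
    obtain ⟨z, hz⟩ := h
    have hz' : (p : ℝ) = z * (2 * k) := by
      field_simp at hz
      linarith
    have hz2 : p = z * (2 * k) := by exact_mod_cast hz'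
    have hz0 : z ≠ 0 := by
      rintro rfl
      simp at hz2
      exact hp0 hz2
    have : 1 ≤ |z| := Int.one_le_abs hz0
    rw [hz2, abs_mul, abs_of_nonneg (by positivity : (0 : ℤ) ≤ 2 * k)] at hp1
    nlinarith [abs_nonneg p]
  · rw [hkp]
    exact sin_int_mul_pi p

/-- The discrete sine basis. -/
noncomputable def sineWeight (k i r : ℕ) : ℝ := √(2 / k) * sin (r * (i * π / k))

/-- The increments of the discrete sine basis, a scaled discrete cosine basis. -/
noncomputable def sineIncrement (k i j : ℕ) : ℝ := sineWeight k i (j + 1) - sineWeight k i j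

lemma sineWeight_zero (k i : ℕ) : sineWeight k i 0 = 0 := by simp [sineWeight]

lemma sineWeight_self {k : ℕ} (hk : 0 < k) (i : ℕ) : sineWeight k i k = 0 := by
  have hk' : (k : ℝ) ≠ 0 := by exact_mod_cast hk.ne'
  have : (k : ℝ) * (i * π / k) = i * π := by field_simp
  rw [sineWeight, this, sin_nat_mul_pi, mul_zero]

/-- The sines vanish at `0` and at `k`. Orthogonality to constants is what later removes the common
mean of the weighted counts. -/
lemma sum_sineIncrement {k : ℕ} (hk : 0 < k) (i : ℕ) :
    ∑ j ∈ Finset.range k, sineIncrement k i j = 0 := by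
  simp only [sineIncrement]
  rw [Finset.sum_range_sub, sineWeight_self hk, sineWeight_zero, sub_zero]

lemma sum_sineIncrement_Ico {k r : ℕ} (hr : r < k) (i : ℕ) :
    ∑ j ∈ Finset.Ico r k, sineIncrement k i j = -sineWeight k i r := by
  simp only [sineIncrement]
  rw [Finset.sum_Ico_sub (sineWeight k i) hr.le, sineWeight_self (by omega), zero_sub]

lemma cos_int_mul_pi_eq_of_even_sub {p p' : ℤ} (h : Even (p - p')) :
    cos (p * π) = cos (p' * π) := by
  obtain ⟨z, hz⟩ := h
  have : (p : ℝ) * π = p' * π + z * (2 * π) := by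
    have : (p : ℝ) - p' = z + z := by exact_mod_cast hz
    linear_combination π * this
  rw [this, cos_add_int_mul_two_pi]

/-- A product of sines is a difference of cosines of frequencies `i - m` and `i + m`. These have
equal parity, so for `i ≠ m` the two cosine sums cancel; for `i = m` they are `k` and `0`. -/
lemma sum_sineWeight_mul {k i m : ℕ} (hi : 0 < i) (hik : i < k) (hm : 0 < m) (hmk : m < k) :
    ∑ r ∈ Finset.range k, sineWeight k i r * sineWeight k m r = if i = m then 1 else 0 := by
  have hk' : (k : ℝ) ≠ 0 := by exact_mod_cast (by omega : k ≠ 0)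
  have hterm : ∀ r ∈ Finset.range k, sineWeight k i r * sineWeight k m r
      = 1 / k * (cos (r * (((i : ℤ) - m : ℤ) * π / k)) - cos (r * (((i : ℤ) + m : ℤ) * π / k))) := by
    intro r _
    have hs : √(2 / (k : ℝ)) * √(2 / k) = 2 / k := Real.mul_self_sqrt (by positivity)
    have e1 : (r : ℝ) * (((i : ℤ) - m : ℤ) * π / k) = r * (i * π / k) - r * (m * π / k) := by
      push_cast; ring
    have e2 : (r : ℝ) * (((i : ℤ) + m : ℤ) * π / k) = r * (i * π / k) + r * (m * π / k) := by
      push_cast; ring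
    rw [e1, e2, cos_sub, cos_add, sineWeight, sineWeight]
    linear_combination sin (r * (i * π / k)) * sin (r * (m * π / k)) * hs
  rw [Finset.sum_congr rfl hterm, ← Finset.mul_sum, Finset.sum_sub_distrib,
    sum_cos_int_mul_pi_div (p := (i : ℤ) + m) (by omega) (by rw [abs_lt]; omega)]
  split_ifs with h
  · subst h
    have : cos ((((i : ℤ) + i : ℤ) : ℝ) * π) = 1 := by
      rw [cos_int_mul_pi_eq_of_even_sub (p' := 0) (by simp)]
      simp
    rw [this]
    simp [hk']
  · rw [sum_cos_int_mul_pi_div (p := (i : ℤ) - m) (by omega) (by rw [abs_lt]; omega),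
      cos_int_mul_pi_eq_of_even_sub (p := (i : ℤ) - m) (p' := (i : ℤ) + m) ⟨-m, by ring⟩]
    ring

/-- A sine increment is a cosine at a half-integer point times `2 sin x` with `x = iπ/(2k)`, and
`limitWeight` is exactly `1/(4 sin² x)`. -/
lemma limitWeight_mul_sineIncrement {k i : ℕ} (hi : 0 < i) (hik : i < k) (j l : ℕ) :
    limitWeight k i * (sineIncrement k i j * sineIncrement k i l)
      = 1 / k * (cos (i * (((j : ℤ) - l : ℤ) * π / k)) + cos (i * (((j : ℤ) + l + 1 : ℤ) * π / k)))
      := by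
  have hk0 : 0 < k := by omega
  have hk' : (0 : ℝ) < k := by exact_mod_cast hk0
  set x : ℝ := i * π / k / 2 with hx
  have hinc : ∀ j : ℕ, sineIncrement k i j = √(2 / k) * (2 * sin x * cos ((2 * j + 1) * x)) := by
    intro j
    have e1 : ((j + 1 : ℕ) : ℝ) * (i * π / k) = (2 * j + 1) * x + x := by
      rw [hx]; push_cast; ring
    have e2 : (j : ℝ) * (i * π / k) = (2 * j + 1) * x - x := by rw [hx]; ring
    rw [sineIncrement, sineWeight, sineWeight, e1, e2, sin_add, sin_sub]
    ring
  have hsin : sin x ≠ 0 := by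
    have hi' : (0 : ℝ) < i := by exact_mod_cast hi
    have hik' : (i : ℝ) < k := by exact_mod_cast hik
    refine (sin_pos_of_pos_of_lt_pi (by positivity) ?_).ne'
    rw [hx, div_div, div_lt_iff₀ (by positivity)]
    nlinarith [pi_pos]
  have hw : limitWeight k i = 1 / (4 * sin x ^ 2) := by
    unfold limitWeight
    congr 4
    rw [hx]
    ring
  have hs : √(2 / (k : ℝ)) * √(2 / k) = 2 / k := Real.mul_self_sqrt (by positivity)
  have e1 : (i : ℝ) * (((j : ℤ) - l : ℤ) * π / k) = (2 * j + 1) * x - (2 * l + 1) * x := by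
    rw [hx]; push_cast; ring
  have e2 : (i : ℝ) * (((j : ℤ) + l + 1 : ℤ) * π / k) = (2 * j + 1) * x + (2 * l + 1) * x := by
    rw [hx]; push_cast; ring
  rw [e1, e2, cos_sub, cos_add, hinc, hinc, hw]
  calc 1 / (4 * sin x ^ 2) * (√(2 / k) * (2 * sin x * cos ((2 * j + 1) * x))
        * (√(2 / k) * (2 * sin x * cos ((2 * l + 1) * x))))
      = (√(2 / k) * √(2 / k)) * (4 * sin x ^ 2 / (4 * sin x ^ 2))
          * (cos ((2 * j + 1) * x) * cos ((2 * l + 1) * x)) := by ring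
    _ = _ := by
      rw [hs, div_self (by positivity)]
      ring

/-- The result is the centring projection. Extending the sum to `i = 0` adds `2/k`. The frequencies
`j - l` and `j + l + 1` have opposite parity, so for `j ≠ l` the two full cosine sums add up to `1`;
for `j = l` they add up to `k + 1`. -/
lemma sum_limitWeight_mul_sineIncrement {k j l : ℕ} (hj : j < k) (hl : l < k) :
    ∑ i : Fin (k - 1), limitWeight k (i + 1)
        * (sineIncrement k (i + 1) j * sineIncrement k (i + 1) l)
      = (if j = l then 1 else 0) - 1 / k := by
  have hk' : (k : ℝ) ≠ 0 := by exact_mod_cast (by omega : k ≠ 0)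
  have hsucc : ∀ f : ℕ → ℝ, ∑ i : Fin (k - 1), f (i + 1) = ∑ i ∈ Finset.range k, f i - f 0 := by
    intro f
    obtain ⟨n, rfl⟩ : ∃ n, k = n + 1 := ⟨k - 1, by omega⟩
    rw [Finset.sum_range_succ', add_sub_cancel_right, Finset.sum_range]
    rfl
  rw [Finset.sum_congr rfl fun (i : Fin (k - 1)) _ =>
    limitWeight_mul_sineIncrement (k := k) (i := i + 1) (by omega) (by omega) j l]
  rw [hsucc fun i => 1 / (k : ℝ) * (cos (i * (((j : ℤ) - l : ℤ) * π / k))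
    + cos (i * (((j : ℤ) + l + 1 : ℤ) * π / k)))]
  rw [← Finset.mul_sum, Finset.sum_add_distrib,
    sum_cos_int_mul_pi_div (p := (j : ℤ) + l + 1) (by omega) (by rw [abs_lt]; omega)]
  split_ifs with h
  · subst h
    have : cos ((((j : ℤ) + j + 1 : ℤ) : ℝ) * π) = -1 := by
      rw [cos_int_mul_pi_eq_of_even_sub (p' := 1) ⟨j, by ring⟩]
      simp
    rw [this]
    simp
    field_simp
    ring
  · rw [sum_cos_int_mul_pi_div (p := (j : ℤ) - l) (by omega) (by rw [abs_lt]; omega)]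
    have h1 : cos ((((j : ℤ) + l + 1 : ℤ) : ℝ) * π) = -cos ((((j : ℤ) - l : ℤ) : ℝ) * π) := by
      rw [cos_int_mul_pi_eq_of_even_sub (p' := (j : ℤ) - l + 1) ⟨l, by ring⟩]
      push_cast
      rw [add_mul, one_mul, cos_add_pi]
    rw [h1]
    simp
    ring

/-- Spectral decomposition of the centred sum of squares. -/
lemma sum_limitWeight_mul_sq {k : ℕ} (y : ℕ → ℝ) :
    ∑ i : Fin (k - 1), limitWeight k (i + 1)
        * (∑ j ∈ Finset.range k, sineIncrement k (i + 1) j * y j) ^ 2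
      = ∑ j ∈ Finset.range k, (y j - 1 / k * ∑ l ∈ Finset.range k, y l) ^ 2 := by
  rcases Nat.eq_zero_or_pos k with rfl | hk
  · simp
  have hk' : (k : ℝ) ≠ 0 := by exact_mod_cast hk.ne'
  have h1 : ∑ i : Fin (k - 1), limitWeight k (i + 1)
        * (∑ j ∈ Finset.range k, sineIncrement k (i + 1) j * y j) ^ 2
      = ∑ j ∈ Finset.range k, ∑ l ∈ Finset.range k, y j * y l
        * ∑ i : Fin (k - 1), limitWeight k (i + 1)
          * (sineIncrement k (i + 1) j * sineIncrement k (i + 1) l) := by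
    simp_rw [sq, Finset.sum_mul_sum, Finset.mul_sum]
    rw [Finset.sum_comm]
    refine Finset.sum_congr rfl fun j _ => ?_
    rw [Finset.sum_comm]
    refine Finset.sum_congr rfl fun l _ => Finset.sum_congr rfl fun i _ => ?_
    ring
  have h2 : ∑ j ∈ Finset.range k, ∑ l ∈ Finset.range k, y j * y l
        * ∑ i : Fin (k - 1), limitWeight k (i + 1)
          * (sineIncrement k (i + 1) j * sineIncrement k (i + 1) l)
      = ∑ j ∈ Finset.range k, ∑ l ∈ Finset.range k, y j * y l
        * ((if j = l then 1 else 0) - 1 / k) :=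
    Finset.sum_congr rfl fun j hj => Finset.sum_congr rfl fun l hl => by
      rw [sum_limitWeight_mul_sineIncrement (Finset.mem_range.1 hj) (Finset.mem_range.1 hl)]
  rw [h1, h2]
  set S := ∑ l ∈ Finset.range k, y l with hS
  have hL : ∑ j ∈ Finset.range k, ∑ l ∈ Finset.range k, y j * y l
        * ((if j = l then 1 else 0) - 1 / k)
      = ∑ j ∈ Finset.range k, y j ^ 2 - 1 / k * S ^ 2 := by
    have : ∀ j ∈ Finset.range k, ∑ l ∈ Finset.range k, y j * y l
        * ((if j = l then 1 else 0) - 1 / k) = y j ^ 2 - y j * (1 / k * S) := by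
      intro j hj
      simp_rw [mul_sub, Finset.sum_sub_distrib, mul_ite, mul_one, mul_zero]
      rw [Finset.sum_ite_eq, if_pos hj, ← Finset.sum_mul, ← Finset.mul_sum]
      ring
    rw [Finset.sum_congr rfl this, Finset.sum_sub_distrib, ← Finset.sum_mul]
    ring
  rw [hL]
  simp_rw [sub_sq, Finset.sum_add_distrib, Finset.sum_sub_distrib, Finset.sum_const,
    Finset.card_range, ← Finset.sum_mul, ← Finset.mul_sum, nsmul_eq_mul]
  rw [← hS]
  field_simp
  ring

/-- The covariance `min (j, l)` of a random walk becomes the identity in the sine basis. -/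
lemma sum_sineIncrement_mul_min {k : ℕ} (θ : Fin (k - 1) → ℝ) :
    ∑ j ∈ Finset.range k, ∑ l ∈ Finset.range k,
        (∑ i, θ i * sineIncrement k (i + 1) j) * (∑ i, θ i * sineIncrement k (i + 1) l)
          * ((min j l + 1 : ℕ) : ℝ)
      = ∑ i, θ i ^ 2 := by
  set a : ℕ → ℝ := fun j => ∑ i, θ i * sineIncrement k (i + 1) j with ha
  -- Random-walk factorization: `min(j,l) + 1` counts the steps shared by the two partial sums, the
  -- index `j` standing for time `j + 1`. The quadratic form becomes a sum of squares of tail sums,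
  -- and these are the orthonormal sines.
  have hmin : ∀ j ∈ Finset.range k, ∀ l, ((min j l + 1 : ℕ) : ℝ)
      = ∑ r ∈ Finset.range k, (if r ≤ j then 1 else 0) * (if r ≤ l then 1 else 0) := by
    intro j hj l
    rw [Finset.mem_range] at hj
    have hprod : ∀ r : ℕ, (if r ≤ j then (1 : ℝ) else 0) * (if r ≤ l then 1 else 0)
        = if r ≤ min j l then 1 else 0 := by
      intro r
      by_cases h : r ≤ j <;> simp [h]
    simp_rw [hprod, Finset.sum_boole]
    congr 1
    have : (Finset.range k).filter (fun r => r ≤ min j l) = Finset.range (min j l + 1) := by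
      ext r
      simp only [Finset.mem_filter, Finset.mem_range]
      omega
    rw [this, Finset.card_range]
  have h1 : ∑ j ∈ Finset.range k, ∑ l ∈ Finset.range k, a j * a l * ((min j l + 1 : ℕ) : ℝ)
      = ∑ r ∈ Finset.range k, (∑ j ∈ Finset.range k, a j * (if r ≤ j then 1 else 0)) ^ 2 := by
    simp_rw [sq, Finset.sum_mul_sum]
    rw [Finset.sum_comm (s := Finset.range k) (t := Finset.range k)
      (f := fun r j => ∑ l ∈ Finset.range k, a j * (if r ≤ j then 1 else 0)
        * (a l * (if r ≤ l then 1 else 0)))]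
    refine Finset.sum_congr rfl fun j hj => ?_
    rw [Finset.sum_comm]
    refine Finset.sum_congr rfl fun l _ => ?_
    rw [hmin j hj l, Finset.mul_sum]
    exact Finset.sum_congr rfl fun r _ => by ring
  rw [h1]
  have h2 : ∀ r ∈ Finset.range k, ∑ j ∈ Finset.range k, a j * (if r ≤ j then 1 else 0)
      = -∑ i, θ i * sineWeight k (i + 1) r := by
    intro r hr
    rw [Finset.mem_range] at hr
    simp_rw [mul_ite, mul_one, mul_zero]
    rw [← Finset.sum_filter]
    have : (Finset.range k).filter (fun j => r ≤ j) = Finset.Ico r k := by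
      ext j
      simp only [Finset.mem_filter, Finset.mem_range, Finset.mem_Ico]
      omega
    rw [this, ha, Finset.sum_comm]
    simp_rw [← Finset.mul_sum, sum_sineIncrement_Ico hr, mul_neg, Finset.sum_neg_distrib]
  rw [Finset.sum_congr rfl fun r hr => by rw [h2 r hr, neg_sq]]
  simp_rw [sq, Finset.sum_mul_sum]
  rw [Finset.sum_comm]
  refine Finset.sum_congr rfl fun i _ => ?_
  rw [Finset.sum_comm]
  have h3 : ∀ m : Fin (k - 1), ∑ r ∈ Finset.range k,
      θ i * sineWeight k (i + 1) r * (θ m * sineWeight k (m + 1) r)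
      = if i = m then θ i * θ m else 0 := by
    intro m
    have := sum_sineWeight_mul (k := k) (i := i + 1) (m := m + 1) (by omega) (by omega) (by omega)
      (by omega)
    calc _ = θ i * θ m * ∑ r ∈ Finset.range k, sineWeight k (i + 1) r * sineWeight k (m + 1) r := by
          rw [Finset.mul_sum]
          exact Finset.sum_congr rfl fun r _ => by ring
      _ = _ := by
          rw [this]
          simp only [add_left_inj, Fin.val_inj, mul_ite, mul_one, mul_zero]
  simp_rw [h3]
  simp

end CosineBasis

/-! ### Convergence in probability and Gaussian vectors. -/

section ConvergenceTools

variable {Ω : Type*} [MeasurableSpace Ω] {P : Measure Ω} [IsProbabilityMeasure P]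

/-- Markov's inequality for an `L¹` majorant. -/
lemma tendstoInMeasure_of_norm_sub_le {E : Type*} [NormedAddCommGroup E] {X : ℕ → Ω → E}
    {g : Ω → E} {Y : ℕ → Ω → ℝ} (hXY : ∀ᶠ n in atTop, ∀ ω, ‖X n ω - g ω‖ ≤ Y n ω)
    (hY : ∀ n, Integrable (Y n) P) (hlim : Tendsto (fun n => ∫ ω, Y n ω ∂P) atTop (𝓝 0)) :
    TendstoInMeasure P X atTop g := by
  rw [tendstoInMeasure_iff_measureReal_norm]
  intro ε hε
  have h2 : Tendsto (fun n => (∫ ω, Y n ω ∂P) / ε) atTop (𝓝 0) := by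
    simpa using hlim.div_const ε
  refine squeeze_zero' (Eventually.of_forall fun n => measureReal_nonneg) ?_ h2
  filter_upwards [hXY] with n hn
  rw [le_div_iff₀ hε, mul_comm]
  refine le_trans ?_ (mul_meas_ge_le_integral_of_nonneg
    (Eventually.of_forall fun ω => (norm_nonneg _).trans (hn ω)) (hY n) ε)
  exact mul_le_mul_of_nonneg_left (measureReal_mono fun ω hω => le_trans hω (hn ω)) hε.le

lemma tendstoInMeasure_inv_of_tendstoInMeasure_one {R : ℕ → Ω → ℝ}
    (hR : TendstoInMeasure P R atTop fun _ => (1 : ℝ)) :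
    TendstoInMeasure P (fun n ω => (R n ω)⁻¹) atTop fun _ => (1 : ℝ) := by
  rw [tendstoInMeasure_iff_measureReal_norm] at hR ⊢
  intro ε hε
  have hcont : Tendsto (fun r : ℝ => r⁻¹) (𝓝 1) (𝓝 1) := by
    simpa using tendsto_inv₀ (one_ne_zero (α := ℝ))
  obtain ⟨η, hη, hball⟩ := Metric.tendsto_nhds_nhds.1 hcont ε hε
  refine squeeze_zero (fun n => measureReal_nonneg) (fun n => ?_) (hR η hη)
  refine measureReal_mono fun ω hω => ?_
  rw [Set.mem_ofPred_eq] at hω ⊢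
  by_contra hcon
  have := hball (x := R n ω) (by rw [Real.dist_eq]; exact not_le.1 hcon)
  rw [Real.dist_eq] at this
  exact absurd hω (not_le.2 this)

lemma norm_toLp_le_sum_abs {ι : Type*} [Fintype ι] (v : ι → ℝ) :
    ‖(WithLp.toLp 2 v : EuclideanSpace ℝ ι)‖ ≤ ∑ i, |v i| := by
  refine le_of_sq_le_sq ?_ (Finset.sum_nonneg fun i _ => abs_nonneg _)
  rw [EuclideanSpace.norm_sq_eq, sq (∑ i, |v i|), Finset.sum_mul]
  refine Finset.sum_le_sum fun i _ => ?_
  rw [sq]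
  refine mul_le_mul_of_nonneg_left ?_ (norm_nonneg _)
  exact Finset.single_le_sum (f := fun i => |v i|) (fun i _ => abs_nonneg _) (Finset.mem_univ i)

lemma charFun_map_toLp_of_iIndepFun_gaussian {ι : Type*} [Fintype ι] {ξ : ι → Ω → ℝ}
    (hlaw : ∀ i, HasLaw (ξ i) (gaussianReal 0 1) P) (hind : iIndepFun ξ P)
    (θ : EuclideanSpace ℝ ι) :
    charFun (P.map fun ω => (WithLp.toLp 2 fun i => ξ i ω : EuclideanSpace ℝ ι)) θ
      = Complex.exp (-(‖θ‖ : ℂ) ^ 2 / 2) := by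
  have h := (iIndepFun_iff_charFun_pi fun i => (hlaw i).aemeasurable).1 hind θ
  rw [h]
  simp_rw [fun i => (hlaw i).map_eq, charFun_gaussianReal]
  rw [← Complex.exp_sum]
  congr 1
  have hn : (‖θ‖ : ℂ) ^ 2 = ∑ i, (θ i : ℂ) ^ 2 := by
    have := EuclideanSpace.norm_sq_eq θ
    simp only [Real.norm_eq_abs, sq_abs] at this
    exact_mod_cast this
  rw [hn, neg_div, Finset.sum_div, ← Finset.sum_neg_distrib]
  refine Finset.sum_congr rfl fun i _ => ?_
  simp

end ConvergenceTools

/-! ### Moments of a single observation's score. -/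

section ScoreVector

open scoped RealInnerProductSpace

variable {𝓧 : Type*} [MeasurableSpace 𝓧] {μ : Measure 𝓧} [IsProbabilityMeasure μ]

/-- The contribution of one observation to the standardized, centred exceedance counts, in the
sine basis. -/
noncomputable def scoreVector (k : ℕ) (A : ℕ → Set 𝓧) (p : ℕ → ℝ) (s : ℝ) (z : 𝓧) :
    EuclideanSpace ℝ (Fin (k - 1)) :=
  WithLp.toLp 2 fun a => ∑ j ∈ Finset.range k,
    sineIncrement k (a + 1) j * ((j + 1) * ((A j).indicator 1 z - p j) / √s)

/-- A bound for the weights of the score vector. -/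
noncomputable def scoreBound (k : ℕ) : ℝ :=
  ∑ a : Fin (k - 1), ∑ j ∈ Finset.range k, |sineIncrement k (a + 1) j| * (j + 1)

lemma measurable_scoreVector (k : ℕ) {A : ℕ → Set 𝓧} (hA : ∀ j, MeasurableSet (A j))
    (p : ℕ → ℝ) (s : ℝ) : Measurable (scoreVector k A p s) := by
  have : ∀ a : Fin (k - 1), Measurable fun z => ∑ j ∈ Finset.range k,
      sineIncrement k (a + 1) j * ((j + 1) * ((A j).indicator 1 z - p j) / √s) := fun a =>
    Finset.measurable_sum _ fun j _ => Measurable.const_mul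
      (((Measurable.sub_const (measurable_one.indicator (hA j)) _).const_mul _).div_const _) _
  unfold scoreVector
  fun_prop

lemma norm_scoreVector_le (k : ℕ) (A : ℕ → Set 𝓧) {p : ℕ → ℝ} (hp : ∀ j, p j ∈ Set.Icc 0 1)
    (s : ℝ) (z : 𝓧) : ‖scoreVector k A p s z‖ ≤ scoreBound k / √s := by
  refine (norm_toLp_le_sum_abs _).trans ?_
  unfold scoreBound
  rw [Finset.sum_div]
  refine Finset.sum_le_sum fun a _ => (Finset.abs_sum_le_sum_abs _ _).trans ?_
  rw [Finset.sum_div]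
  refine Finset.sum_le_sum fun j _ => ?_
  have hj : |((A j).indicator 1 z : ℝ) - p j| ≤ 1 := by
    obtain ⟨h0, h1⟩ := hp j
    by_cases h : z ∈ A j
    · simp only [h, Set.indicator_of_mem, Pi.one_apply]
      rw [abs_le]; constructor <;> linarith
    · simp only [h, not_false_eq_true, Set.indicator_of_notMem]
      rw [abs_le]; constructor <;> linarith
  have hj1 : |((j : ℝ) + 1)| = j + 1 := abs_of_nonneg (by positivity)
  rw [abs_mul, abs_div, abs_mul, abs_of_nonneg (Real.sqrt_nonneg s), hj1,
    mul_div_assoc |sineIncrement k (a + 1) j|]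
  have : (j + 1) * |((A j).indicator 1 z : ℝ) - p j| ≤ j + 1 :=
    mul_le_of_le_one_right (by positivity) hj
  gcongr

/-- The coefficient of the `j`-th count in the direction `θ`. -/
noncomputable def scoreCoeff (k : ℕ) (θ : EuclideanSpace ℝ (Fin (k - 1))) (j : ℕ) : ℝ :=
  ∑ a, θ a * sineIncrement k (a + 1) j

lemma inner_scoreVector (k : ℕ) (A : ℕ → Set 𝓧) (p : ℕ → ℝ) (s : ℝ) (z : 𝓧)
    (θ : EuclideanSpace ℝ (Fin (k - 1))) :
    ⟪scoreVector k A p s z, θ⟫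
      = ∑ j ∈ Finset.range k, scoreCoeff k θ j * (j + 1) / √s * ((A j).indicator 1 z - p j) := by
  rw [PiLp.inner_apply]
  simp only [scoreVector, scoreCoeff, RCLike.inner_apply, conj_trivial, Finset.mul_sum,
    Finset.sum_mul, Finset.sum_div]
  rw [Finset.sum_comm]
  refine Finset.sum_congr rfl fun j _ => Finset.sum_congr rfl fun a _ => ?_
  ring

lemma integral_inner_scoreVector (k : ℕ) {A : ℕ → Set 𝓧} (hA : ∀ j, MeasurableSet (A j))
    (s : ℝ) (θ : EuclideanSpace ℝ (Fin (k - 1))) :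
    ∫ z, ⟪scoreVector k A (fun j => μ.real (A j)) s z, θ⟫ ∂μ = 0 := by
  simp_rw [inner_scoreVector]
  have hint : ∀ j, Integrable (fun z => ((A j).indicator 1 z : ℝ)) μ := fun j =>
    (integrable_const (1 : ℝ)).indicator (hA j)
  have hint' : ∀ j, Integrable (fun z => ((A j).indicator 1 z : ℝ) - μ.real (A j)) μ := fun j =>
    (hint j).sub (integrable_const _)
  rw [integral_finsetSum _ fun j _ => (hint' j).const_mul _]
  refine Finset.sum_eq_zero fun j _ => ?_
  rw [integral_const_mul, integral_sub (hint j) (integrable_const _),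
    integral_indicator_one (hA j)]
  simp

lemma integral_inner_scoreVector_sq (k : ℕ) {A : ℕ → Set 𝓧} (hA : ∀ j, MeasurableSet (A j))
    {s : ℝ} (hs : 0 ≤ s) (θ : EuclideanSpace ℝ (Fin (k - 1))) :
    ∫ z, ⟪scoreVector k A (fun j => μ.real (A j)) s z, θ⟫ ^ 2 ∂μ
      = ∑ j ∈ Finset.range k, ∑ l ∈ Finset.range k, scoreCoeff k θ j * scoreCoeff k θ l
        * ((j + 1) * (l + 1) * (μ.real (A j ∩ A l) - μ.real (A j) * μ.real (A l)) / s) := by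
  have hint : ∀ B, MeasurableSet B → Integrable (fun z => (B.indicator 1 z : ℝ)) μ := fun B hB =>
    (integrable_const (1 : ℝ)).indicator hB
  have hprod : ∀ j l z, ((A j).indicator (1 : 𝓧 → ℝ) z - μ.real (A j))
      * ((A l).indicator 1 z - μ.real (A l))
      = (A j ∩ A l).indicator 1 z - μ.real (A l) * (A j).indicator 1 z
        - μ.real (A j) * (A l).indicator 1 z + μ.real (A j) * μ.real (A l) := by
    intro j l z
    by_cases h1 : z ∈ A j <;> by_cases h2 : z ∈ A l <;> simp [h1, h2] <;> ring
  have i1 : ∀ j l, Integrable (fun z => (A j ∩ A l).indicator (1 : 𝓧 → ℝ) z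
      - μ.real (A l) * (A j).indicator 1 z) μ := fun j l =>
    (hint _ ((hA j).inter (hA l))).sub ((hint _ (hA j)).const_mul _)
  have i2 : ∀ j l, Integrable (fun z => (A j ∩ A l).indicator (1 : 𝓧 → ℝ) z
      - μ.real (A l) * (A j).indicator 1 z - μ.real (A j) * (A l).indicator 1 z) μ := fun j l =>
    (i1 j l).sub ((hint _ (hA l)).const_mul _)
  have hcov : ∀ j l, ∫ z, ((A j).indicator (1 : 𝓧 → ℝ) z - μ.real (A j))
      * ((A l).indicator 1 z - μ.real (A l)) ∂μ
      = μ.real (A j ∩ A l) - μ.real (A j) * μ.real (A l) := by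
    intro j l
    simp_rw [hprod]
    rw [integral_add (i2 j l) (integrable_const _), integral_sub (i1 j l)
      ((hint _ (hA l)).const_mul _), integral_sub (hint _ ((hA j).inter (hA l)))
      ((hint _ (hA j)).const_mul _), integral_const_mul, integral_const_mul,
      integral_indicator_one (hA j), integral_indicator_one (hA l),
      integral_indicator_one ((hA j).inter (hA l))]
    simp
    ring
  have hcovi : ∀ j l, Integrable (fun z => ((A j).indicator (1 : 𝓧 → ℝ) z - μ.real (A j))
      * ((A l).indicator 1 z - μ.real (A l))) μ := by
    intro j l
    simp_rw [hprod]
    exact (i2 j l).add (integrable_const _)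
  simp_rw [inner_scoreVector, sq, Finset.sum_mul_sum]
  have hre : ∀ j l z, scoreCoeff k θ j * (j + 1) / √s * ((A j).indicator (1 : 𝓧 → ℝ) z - μ.real (A j))
      * (scoreCoeff k θ l * (l + 1) / √s * ((A l).indicator 1 z - μ.real (A l)))
      = scoreCoeff k θ j * scoreCoeff k θ l * ((j + 1) * (l + 1) / s)
        * (((A j).indicator 1 z - μ.real (A j)) * ((A l).indicator 1 z - μ.real (A l))) := by
    intro j l z
    nth_rw 3 [← Real.mul_self_sqrt hs]
    ring
  simp_rw [hre]
  rw [integral_finsetSum _ fun j _ => integrable_finsetSum _ fun l _ => (hcovi j l).const_mul _]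
  refine Finset.sum_congr rfl fun j _ => ?_
  rw [integral_finsetSum _ fun l _ => (hcovi j l).const_mul _]
  refine Finset.sum_congr rfl fun l _ => ?_
  rw [integral_const_mul, hcov]
  ring

end ScoreVector

/-! ### Limit law for counts in nested rare sets. -/

section CountStatistic

open scoped RealInnerProductSpace

variable {𝓧 : Type*} [MeasurableSpace 𝓧] {μ : Measure 𝓧} [IsProbabilityMeasure μ]

lemma tendsto_div_of_tendsto_sub_div_sqrt {x s : ℕ → ℝ} (hs : ∀ n, 0 < s n)
    (hs_atTop : Tendsto s atTop atTop)
    (h : Tendsto (fun n => (x n - s n) / √(s n)) atTop (𝓝 0)) :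
    Tendsto (fun n => x n / s n) atTop (𝓝 1) := by
  have hinv : Tendsto (fun n => (√(s n))⁻¹) atTop (𝓝 0) :=
    tendsto_inv_atTop_zero.comp (Real.tendsto_sqrt_atTop.comp hs_atTop)
  have := (h.mul hinv).add_const 1
  simp only [zero_mul, zero_add] at this
  refine this.congr fun n => ?_
  have h1 : √(s n) * √(s n) = s n := Real.mul_self_sqrt (hs n).le
  have h2 := (hs n).ne'
  rw [← div_eq_mul_inv, div_div, h1, sub_div, div_self h2]
  ring

/-- Nesting gives `A_j ∩ A_l = A_(max j l)`, and `(j+1)(l+1)` is the product over minimum and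
maximum, so `m` times the scaled intersection term tends to `min(j,l) + 1`. The product of the
probabilities is negligible because the sets are rare. The sine basis then yields the identity. -/
lemma tendsto_card_mul_integral_inner_scoreVector_sq {k : ℕ} {A : ℕ → ℕ → Set 𝓧}
    (hA : ∀ n j, MeasurableSet (A n j)) {m : ℕ → ℕ} {s : ℕ → ℝ} (hs : ∀ n, 0 < s n)
    (hanti : ∀ᶠ n in atTop, ∀ j l, j ≤ l → l < k → A n l ⊆ A n j)
    (hp0 : ∀ j < k, Tendsto (fun n => μ.real (A n j)) atTop (𝓝 0))
    (hratio : ∀ j < k, Tendsto (fun n => (j + 1) * (m n * μ.real (A n j)) / s n) atTop (𝓝 1))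
    (θ : EuclideanSpace ℝ (Fin (k - 1))) :
    Tendsto (fun n => (m n : ℝ)
        * ∫ z, ⟪scoreVector k (A n) (fun j => μ.real (A n j)) (s n) z, θ⟫ ^ 2 ∂μ)
      atTop (𝓝 (‖θ‖ ^ 2)) := by
  have hnorm : ‖θ‖ ^ 2 = ∑ j ∈ Finset.range k, ∑ l ∈ Finset.range k,
      scoreCoeff k θ j * scoreCoeff k θ l * ((min j l + 1 : ℕ) : ℝ) := by
    have := sum_sineIncrement_mul_min (k := k) (fun i => θ i)
    simp only [scoreCoeff]
    rw [this, EuclideanSpace.norm_sq_eq]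
    simp
  rw [hnorm]
  have hterm : ∀ j ∈ Finset.range k, ∀ l ∈ Finset.range k,
      Tendsto (fun n => scoreCoeff k θ j * scoreCoeff k θ l * ((m n : ℝ)
        * ((j + 1) * (l + 1) * (μ.real (A n j ∩ A n l) - μ.real (A n j) * μ.real (A n l)) / s n)))
      atTop (𝓝 (scoreCoeff k θ j * scoreCoeff k θ l * ((min j l + 1 : ℕ) : ℝ))) := by
    intro j hj l hl
    rw [Finset.mem_range] at hj hl
    refine Tendsto.const_mul _ ?_
    have h1 := (hratio (max j l) (max_lt hj hl)).const_mul ((min j l + 1 : ℕ) : ℝ)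
    have h2 := (hratio j hj).mul ((hp0 l hl).const_mul ((l : ℝ) + 1))
    have h3 := h1.sub h2
    simp only [mul_one, mul_zero, sub_zero] at h3
    refine h3.congr' ?_
    filter_upwards [hanti] with n hn
    have hinter : A n j ∩ A n l = A n (max j l) := by
      rcases le_total j l with hjl | hjl
      · rw [max_eq_right hjl, Set.inter_eq_right.2 (hn j l hjl hl)]
      · rw [max_eq_left hjl, Set.inter_eq_left.2 (hn l j hjl hj)]
    have hminmax : ((min j l + 1 : ℕ) : ℝ) * (((max j l : ℕ) : ℝ) + 1) = (j + 1) * (l + 1) := by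
      rcases le_total j l with hjl | hjl
      · rw [max_eq_right hjl, min_eq_left hjl]; push_cast; ring
      · rw [max_eq_left hjl, min_eq_right hjl]; push_cast; ring
    rw [hinter, ← hminmax]
    have hne := (hs n).ne'
    have hfac : ((m n : ℝ) * (((min j l + 1 : ℕ) : ℝ) * (((max j l : ℕ) : ℝ) + 1)
        * (μ.real (A n (max j l)) - μ.real (A n j) * μ.real (A n l)) / s n))
        = ((min j l + 1 : ℕ) : ℝ) * ((((max j l : ℕ) : ℝ) + 1) * (m n * μ.real (A n (max j l))) / s n)
          - (((min j l + 1 : ℕ) : ℝ) * (((max j l : ℕ) : ℝ) + 1)) * (m n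
            * (μ.real (A n j) * μ.real (A n l))) / s n := by ring
    rw [hfac, hminmax]
    ring
  refine (tendsto_finsetSum _ fun j hj => tendsto_finsetSum _ fun l hl => hterm j hj l hl).congr
    fun n => ?_
  rw [integral_inner_scoreVector_sq k (hA n) (hs n).le, Finset.mul_sum]
  refine Finset.sum_congr rfl fun j _ => ?_
  rw [Finset.mul_sum]
  exact Finset.sum_congr rfl fun l _ => by ring

variable {Ω : Type*} [MeasurableSpace Ω] {P : Measure Ω} [IsProbabilityMeasure P]
  {Ω' : Type*} [MeasurableSpace Ω'] {P' : Measure Ω'} [IsProbabilityMeasure P']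

/-- The number of observations with index in `M` that lie in `B`. -/
noncomputable def hitCount (M : Finset ℕ) (B : Set 𝓧) (y : ℕ → Ω → 𝓧) (ω : Ω) : ℝ :=
  ∑ i ∈ M, B.indicator 1 (y i ω)

lemma integrable_hitCount (M : Finset ℕ) {B : Set 𝓧} (hB : MeasurableSet B) {y : ℕ → Ω → 𝓧}
    (hy : ∀ i, Measurable (y i)) : Integrable (hitCount M B y) P :=
  integrable_finsetSum _ fun i _ => (memLp_indicator_comp (hy i) hB).integrable one_le_two

/-- The centred and standardized counts, in the sine basis, converge to a standard normal
vector. -/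
lemma tendstoInDistribution_sum_scoreVector {k : ℕ} {y : ℕ → Ω → 𝓧} (hy : ∀ i, Measurable (y i))
    (hind : iIndepFun y P) (hlaw : ∀ i, P.map (y i) = μ)
    {A : ℕ → ℕ → Set 𝓧} (hA : ∀ n j, MeasurableSet (A n j)) {M : ℕ → Finset ℕ}
    (hm : Tendsto (fun n => (M n).card) atTop atTop)
    {s : ℕ → ℝ} (hs : ∀ n, 0 < s n) (hs_atTop : Tendsto s atTop atTop)
    (hanti : ∀ᶠ n in atTop, ∀ j l, j ≤ l → l < k → A n l ⊆ A n j)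
    (hp0 : ∀ j < k, Tendsto (fun n => μ.real (A n j)) atTop (𝓝 0))
    (hratio : ∀ j < k, Tendsto (fun n => (j + 1) * ((M n).card * μ.real (A n j)) / s n)
      atTop (𝓝 1))
    {ξ : Fin (k - 1) → Ω' → ℝ} (hξ : ∀ i, HasLaw (ξ i) (gaussianReal 0 1) P')
    (hξind : iIndepFun ξ P') :
    TendstoInDistribution
      (fun n ω => ∑ i ∈ M n, scoreVector k (A n) (fun j => μ.real (A n j)) (s n) (y i ω)) atTop
      (fun ω => (WithLp.toLp 2 fun i => ξ i ω : EuclideanSpace ℝ (Fin (k - 1))))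
      (fun _ => P) P' := by
  have hmeas : ∀ n, Measurable (scoreVector k (A n) (fun j => μ.real (A n j)) (s n)) := fun n =>
    measurable_scoreVector k (hA n) _ _
  have hinner : ∀ n (θ : EuclideanSpace ℝ (Fin (k - 1))), Measurable fun z =>
      ⟪scoreVector k (A n) (fun j => μ.real (A n j)) (s n) z, θ⟫ := fun n θ =>
    (hmeas n).inner_const
  have htr : ∀ f : 𝓧 → ℝ, Measurable f → ∫ ω, f (y 0 ω) ∂P = ∫ z, f z ∂μ := by
    intro f hf
    rw [← integral_map (hy 0).aemeasurable hf.aestronglyMeasurable, hlaw 0]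
  have hbound : Tendsto (fun n => scoreBound k / √(s n)) atTop (𝓝 0) :=
    tendsto_const_nhds.div_atTop (Real.tendsto_sqrt_atTop.comp hs_atTop)
  refine tendstoInDistribution_sum_of_rowwise_iid (fun n i => (hmeas n).comp (hy i))
    (fun n => hind.comp _ fun _ => hmeas n) (fun n i => ?_) hbound
    (Eventually.of_forall fun n ω => norm_scoreVector_le k (A n)
      (fun j => ⟨measureReal_nonneg, measureReal_le_one⟩) (s n) _) (fun n θ => ?_) hm (fun θ => ?_)
    ?_ (charFun_map_toLp_of_iIndepFun_gaussian hξ hξind)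
  · rw [← Measure.map_map (hmeas n) (hy i), ← Measure.map_map (hmeas n) (hy 0), hlaw, hlaw]
  · exact (htr _ (hinner n θ)).trans (integral_inner_scoreVector k (hA n) (s n) θ)
  · have := tendsto_card_mul_integral_inner_scoreVector_sq (μ := μ) hA hs hanti hp0 hratio θ
    refine this.congr fun n => ?_
    rw [← htr _ ((hinner n θ).pow_const 2)]
    rfl
  · have := fun i => (hξ i).aemeasurable
    exact (WithLp.measurable_toLp 2 _).comp_aemeasurable (aemeasurable_pi_lambda _ this)

/-- Asymptotics of the test statistic for approximate counts `N` of i.i.d. observations falling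
into nested rare sets. -/
theorem tendstoInDistribution_count_statistic {k : ℕ} (hk : 0 < k) {y : ℕ → Ω → 𝓧}
    (hy : ∀ i, Measurable (y i))
    (hind : iIndepFun y P) (hlaw : ∀ i, P.map (y i) = μ)
    {A : ℕ → ℕ → Set 𝓧} (hA : ∀ n j, MeasurableSet (A n j)) {M : ℕ → Finset ℕ}
    (hm : Tendsto (fun n => (M n).card) atTop atTop)
    {s : ℕ → ℝ} (hs : ∀ n, 0 < s n) (hs_atTop : Tendsto s atTop atTop)
    (hanti : ∀ᶠ n in atTop, ∀ j l, j ≤ l → l < k → A n l ⊆ A n j)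
    (hp0 : ∀ j < k, Tendsto (fun n => μ.real (A n j)) atTop (𝓝 0))
    (hmean : ∀ j < k, Tendsto (fun n => ((j + 1) * ((M n).card * μ.real (A n j)) - s n) / √(s n))
      atTop (𝓝 0))
    {N : ℕ → ℕ → Ω → ℝ} (hN : ∀ n j, Measurable (N n j)) (hNint : ∀ n j, Integrable (N n j) P)
    (herr : ∀ j < k, Tendsto (fun n => (∫ ω, |N n j ω - hitCount (M n) (A n j) y ω| ∂P) / √(s n))
      atTop (𝓝 0))
    {ξ : Fin (k - 1) → Ω' → ℝ} (hξ : ∀ i, HasLaw (ξ i) (gaussianReal 0 1) P')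
    (hξind : iIndepFun ξ P') :
    TendstoInDistribution
      (fun n ω => (∑ j ∈ Finset.range k, ((j + 1) * N n j ω
          - 1 / k * ∑ l ∈ Finset.range k, (l + 1) * N n l ω) ^ 2)
        / (1 / k * ∑ l ∈ Finset.range k, (l + 1) * N n l ω))
      atTop (fun ω => ∑ i : Fin (k - 1), limitWeight k (i + 1) * ξ i ω ^ 2) (fun _ => P) P' := by
  have hratio : ∀ j < k, Tendsto (fun n => (j + 1) * ((M n).card * μ.real (A n j)) / s n)
      atTop (𝓝 1) := fun j hj => tendsto_div_of_tendsto_sub_div_sqrt hs hs_atTop (hmean j hj)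
  have hinv : Tendsto (fun n => (√(s n))⁻¹) atTop (𝓝 0) :=
    tendsto_inv_atTop_zero.comp (Real.tendsto_sqrt_atTop.comp hs_atTop)
  have hss : ∀ n, √(s n) * √(s n) = s n := fun n => Real.mul_self_sqrt (hs n).le
  have hdd : ∀ n x, x / √(s n) * (√(s n))⁻¹ = x / s n := fun n x => by
    rw [← div_eq_mul_inv, div_div, hss]
  have hsp : ∀ n, 0 < √(s n) := fun n => Real.sqrt_pos.2 (hs n)
  have hclt := tendstoInDistribution_sum_scoreVector hy hind hlaw hA hm hs hs_atTop hanti hp0 hratio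
    hξ hξind
  set C : ℕ → ℕ → Ω → ℝ := fun n j => hitCount (M n) (A n j) y with hC
  have hCint : ∀ n j, Integrable (C n j) P := fun n j => integrable_hitCount (M n) (hA n j) hy
  have hDint : ∀ n j, Integrable (fun ω => |N n j ω - C n j ω|) P := fun n j =>
    ((hNint n j).sub (hCint n j)).abs
  set p : ℕ → ℕ → ℝ := fun n j => μ.real (A n j) with hp
  -- the standardized approximate counts
  set W : ℕ → Ω → EuclideanSpace ℝ (Fin (k - 1)) := fun n ω => WithLp.toLp 2 fun a =>
    ∑ j ∈ Finset.range k, sineIncrement k (a + 1) j * ((j + 1) * N n j ω / √(s n)) with hW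
  have hWmeas : ∀ n, Measurable (W n) := by
    intro n
    have : ∀ a : Fin (k - 1), Measurable fun ω => ∑ j ∈ Finset.range k,
        sineIncrement k (a + 1) j * ((j + 1) * N n j ω / √(s n)) := fun a =>
      Finset.measurable_sum _ fun j _ => (((hN n j).const_mul _).div_const _).const_mul _
    rw [hW]
    fun_prop
  have hWdiff : ∀ n ω, W n ω - ∑ i ∈ M n, scoreVector k (A n) (p n) (s n) (y i ω)
      = WithLp.toLp 2 fun a : Fin (k - 1) => ∑ j ∈ Finset.range k, sineIncrement k (a + 1) j
        * ((j + 1) * (N n j ω - C n j ω) / √(s n)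
          + ((j + 1) * ((M n).card * p n j) - s n) / √(s n)) := by
    intro n ω
    ext a
    simp only [hW, scoreVector, PiLp.sub_apply, WithLp.ofLp_sum, Finset.sum_apply, hC, hitCount]
    rw [Finset.sum_comm]
    -- Increments sum to zero, so the common centring `s n` may be inserted for free; only the
    -- deviation of each mean from `s n` remains.
    have h0 : ∑ j ∈ Finset.range k, sineIncrement k (a + 1) j * (s n / √(s n)) = 0 := by
      rw [← Finset.sum_mul, sum_sineIncrement hk, zero_mul]
    have h2 : ∀ j ∈ Finset.range k, ∑ i ∈ M n, sineIncrement k (a + 1) j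
        * (((j : ℝ) + 1) * ((A n j).indicator 1 (y i ω) - p n j) / √(s n))
        = sineIncrement k (a + 1) j * (((j : ℝ) + 1)
          * (∑ i ∈ M n, (A n j).indicator 1 (y i ω) - (M n).card * p n j) / √(s n)) := by
      intro j _
      rw [← Finset.mul_sum, ← Finset.sum_div, ← Finset.mul_sum, Finset.sum_sub_distrib]
      simp
    rw [Finset.sum_congr rfl h2,
      ← sub_zero (∑ j ∈ Finset.range k, sineIncrement k (a + 1) j * (((j : ℝ) + 1) * N n j ω / √(s n))
        - _), ← h0, ← Finset.sum_sub_distrib,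
      ← Finset.sum_sub_distrib]
    exact Finset.sum_congr rfl fun j _ => by ring
  have hWlim : TendstoInDistribution W atTop
      (fun ω => (WithLp.toLp 2 fun i => ξ i ω : EuclideanSpace ℝ (Fin (k - 1))))
      (fun _ => P) P' := by
    -- Slutsky: the difference from the exact score sum consists of the count error, small in `L¹`,
    -- and a vanishing deterministic bias.
    refine tendstoInDistribution_of_tendstoInMeasure_sub _ _ hclt ?_ fun n => (hWmeas n).aemeasurable
    refine tendstoInMeasure_of_norm_sub_le (Y := fun n ω => ∑ a : Fin (k - 1),
      ∑ j ∈ Finset.range k, |sineIncrement k (a + 1) j| * ((j + 1) * (|N n j ω - C n j ω| / √(s n))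
        + |((j + 1) * ((M n).card * p n j) - s n) / √(s n)|)) ?_ ?_ ?_
    · refine Eventually.of_forall fun n ω => ?_
      simp only [Pi.zero_apply, sub_zero, Pi.sub_apply]
      rw [hWdiff]
      refine (norm_toLp_le_sum_abs _).trans (Finset.sum_le_sum fun a _ =>
        (Finset.abs_sum_le_sum_abs _ _).trans (Finset.sum_le_sum fun j _ => ?_))
      rw [abs_mul]
      refine mul_le_mul_of_nonneg_left ((abs_add_le _ _).trans ?_) (abs_nonneg _)
      have hj1 : |((j : ℝ) + 1)| = j + 1 := abs_of_nonneg (by positivity)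
      rw [abs_div (((j : ℝ) + 1) * _), abs_mul, abs_of_pos (hsp n), hj1, mul_div_assoc]
    · intro n
      exact integrable_finsetSum _ fun a _ => integrable_finsetSum _ fun j _ =>
        ((((hDint n j).div_const _).const_mul _).add (integrable_const _)).const_mul _
    · have hcalc : ∀ n, ∫ ω, ∑ a : Fin (k - 1), ∑ j ∈ Finset.range k, |sineIncrement k (a + 1) j|
          * ((j + 1) * (|N n j ω - C n j ω| / √(s n))
            + |((j + 1) * ((M n).card * p n j) - s n) / √(s n)|) ∂P
          = ∑ a : Fin (k - 1), ∑ j ∈ Finset.range k, |sineIncrement k (a + 1) j|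
          * ((j + 1) * ((∫ ω, |N n j ω - C n j ω| ∂P) / √(s n))
            + |((j + 1) * ((M n).card * p n j) - s n) / √(s n)|) := by
        intro n
        have i1 : ∀ j : ℕ, Integrable (fun ω => ((j : ℝ) + 1) * (|N n j ω - C n j ω| / √(s n))) P :=
          fun j => ((hDint n j).div_const _).const_mul _
        have i2 : ∀ (c : ℝ) (j : ℕ), Integrable (fun ω => c
            * (((j : ℝ) + 1) * (|N n j ω - C n j ω| / √(s n))
            + |((j + 1) * ((M n).card * p n j) - s n) / √(s n)|)) P :=
          fun c j => ((i1 j).add (integrable_const _)).const_mul _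
        rw [integral_finsetSum _ fun a _ => integrable_finsetSum _ fun j _ => i2 _ j]
        refine Finset.sum_congr rfl fun a _ => ?_
        rw [integral_finsetSum _ fun j _ => i2 _ j]
        refine Finset.sum_congr rfl fun j _ => ?_
        rw [integral_const_mul, integral_add (i1 j) (integrable_const _), integral_const_mul,
          integral_div]
        simp
      simp_rw [hcalc]
      have : Tendsto (fun n => ∑ a : Fin (k - 1), ∑ j ∈ Finset.range k,
          |sineIncrement k (a + 1) j| * ((j + 1) * ((∫ ω, |N n j ω - C n j ω| ∂P) / √(s n))
            + |((j + 1) * ((M n).card * p n j) - s n) / √(s n)|)) atTop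
          (𝓝 (∑ a : Fin (k - 1), ∑ j ∈ Finset.range k, |sineIncrement k (a + 1) j|
            * (((j : ℝ) + 1) * 0 + |(0 : ℝ)|))) := by
        refine tendsto_finsetSum _ fun a _ => tendsto_finsetSum _ fun j hj => ?_
        have hj' := Finset.mem_range.1 hj
        exact (((herr j hj').const_mul _).add (hmean j hj').abs).const_mul _
      simpa using this
  -- the standardized average
  set R : ℕ → Ω → ℝ := fun n ω => (1 / k * ∑ l ∈ Finset.range k, (l + 1) * N n l ω) / s n with hR
  have hRmeas : ∀ n, Measurable (R n) := fun n =>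
    ((Finset.measurable_sum _ fun l _ => (hN n l).const_mul _).const_mul _).div_const _
  -- Three errors relative to `s n`: replacing `N` by the true count, the binomial fluctuation of
  -- order `√(m p)`, and the bias of the mean.
  have hRlim : TendstoInMeasure P R atTop fun _ => (1 : ℝ) := by
    have hk' : (0 : ℝ) < k := by exact_mod_cast hk
    have hVint : ∀ n j, Integrable (fun ω => |C n j ω - (M n).card * p n j|) P := fun n j =>
      ((hCint n j).sub (integrable_const _)).abs
    have hV : ∀ n j, ∫ ω, |C n j ω - (M n).card * p n j| ∂P ≤ √((M n).card * p n j) := by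
      intro n j
      refine integral_abs_sum_indicator_sub_le hy hind (hA n j) (fun i => ?_) (M n)
      rw [← map_measureReal_apply (hy i) (hA n j), hlaw i]
    refine tendstoInMeasure_of_norm_sub_le (Y := fun n ω => ∑ j ∈ Finset.range k,
      ((j + 1) * (|N n j ω - C n j ω| / √(s n)) * (√(s n))⁻¹
        + (j + 1) * (|C n j ω - (M n).card * p n j| / s n)
        + |((j + 1) * ((M n).card * p n j) - s n) / √(s n)| * (√(s n))⁻¹)) ?_ ?_ ?_
    · refine Eventually.of_forall fun n ω => ?_
      have hRe : R n ω - 1 = ∑ j ∈ Finset.range k, 1 / (k : ℝ)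
          * (((j + 1) * (N n j ω - C n j ω) + (j + 1) * (C n j ω - (M n).card * p n j)
            + ((j + 1) * ((M n).card * p n j) - s n)) / s n) := by
        have h1 : ∀ j : ℕ, ((j + 1) * (N n j ω - C n j ω) + (j + 1) * (C n j ω - (M n).card * p n j)
            + ((j + 1) * ((M n).card * p n j) - s n)) / s n
            = (j + 1) * N n j ω / s n - 1 := by
          intro j
          have := (hs n).ne'
          field_simp
          ring
        simp_rw [h1, mul_sub, Finset.sum_sub_distrib, Finset.sum_const, Finset.card_range]
        rw [hR, nsmul_eq_mul]
        simp only [Finset.mul_sum, Finset.sum_div, mul_div_assoc]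
        field_simp
      rw [hRe]
      refine (Finset.abs_sum_le_sum_abs _ _).trans (Finset.sum_le_sum fun j _ => ?_)
      have hj1 : |((j : ℝ) + 1)| = j + 1 := abs_of_nonneg (by positivity)
      have hk1 : 1 / (k : ℝ) ≤ 1 := by
        rw [div_le_one hk']
        exact_mod_cast hk
      rw [abs_mul, abs_of_nonneg (by positivity : (0 : ℝ) ≤ 1 / k)]
      refine (mul_le_of_le_one_left (abs_nonneg _) hk1).trans ?_
      rw [abs_div, abs_of_pos (hs n)]
      have e1 : ((j : ℝ) + 1) * (|N n j ω - C n j ω| / √(s n)) * (√(s n))⁻¹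
          = |((j : ℝ) + 1) * (N n j ω - C n j ω)| / s n := by
        rw [abs_mul, hj1, ← mul_div_assoc, hdd]
      have e2 : ((j : ℝ) + 1) * (|C n j ω - (M n).card * p n j| / s n)
          = |((j : ℝ) + 1) * (C n j ω - (M n).card * p n j)| / s n := by
        rw [abs_mul, hj1]
        ring
      have e3 : |(((j : ℝ) + 1) * ((M n).card * p n j) - s n) / √(s n)| * (√(s n))⁻¹
          = |((j : ℝ) + 1) * ((M n).card * p n j) - s n| / s n := by
        rw [abs_div, abs_of_pos (hsp n), hdd]
      rw [e1, e2, e3, ← add_div, ← add_div]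
      have := hs n
      gcongr
      exact abs_add_three _ _ _
    · intro n
      exact integrable_finsetSum _ fun j _ =>
        (((((hDint n j).div_const _).const_mul _).mul_const _).add
          (((hVint n j).div_const _).const_mul _)).add (integrable_const _)
    · have hcalc : ∀ n, ∫ ω, ∑ j ∈ Finset.range k,
          (((j : ℝ) + 1) * (|N n j ω - C n j ω| / √(s n)) * (√(s n))⁻¹
            + (j + 1) * (|C n j ω - (M n).card * p n j| / s n)
            + |((j + 1) * ((M n).card * p n j) - s n) / √(s n)| * (√(s n))⁻¹) ∂P
          ≤ ∑ j ∈ Finset.range k,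
          (((j : ℝ) + 1) * ((∫ ω, |N n j ω - C n j ω| ∂P) / √(s n)) * (√(s n))⁻¹
            + (j + 1) * (√((M n).card * p n j / s n) * (√(s n))⁻¹)
            + |((j + 1) * ((M n).card * p n j) - s n) / √(s n)| * (√(s n))⁻¹) := by
        intro n
        have i1 : ∀ j : ℕ, Integrable
            (fun ω => ((j : ℝ) + 1) * (|N n j ω - C n j ω| / √(s n)) * (√(s n))⁻¹) P :=
          fun j => (((hDint n j).div_const _).const_mul _).mul_const _
        have i2 : ∀ j : ℕ, Integrable
            (fun ω => ((j : ℝ) + 1) * (|C n j ω - (M n).card * p n j| / s n)) P :=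
          fun j => ((hVint n j).div_const _).const_mul _
        have i12 : ∀ j : ℕ, Integrable
            (fun ω => ((j : ℝ) + 1) * (|N n j ω - C n j ω| / √(s n)) * (√(s n))⁻¹
              + ((j : ℝ) + 1) * (|C n j ω - (M n).card * p n j| / s n)) P :=
          fun j => (i1 j).add (i2 j)
        have i3 : ∀ j : ℕ, Integrable
            (fun ω => ((j : ℝ) + 1) * (|N n j ω - C n j ω| / √(s n)) * (√(s n))⁻¹
              + ((j : ℝ) + 1) * (|C n j ω - (M n).card * p n j| / s n)
              + |((j + 1) * ((M n).card * p n j) - s n) / √(s n)| * (√(s n))⁻¹) P :=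
          fun j => (i12 j).add (integrable_const _)
        rw [integral_finsetSum _ fun j _ => i3 j]
        refine Finset.sum_le_sum fun j _ => ?_
        rw [integral_add (i12 j) (integrable_const _), integral_add (i1 j) (i2 j),
          integral_mul_const, integral_const_mul, integral_div, integral_const_mul, integral_div]
        have hb : (∫ ω, |C n j ω - (M n).card * p n j| ∂P) / s n
            ≤ √((M n).card * p n j / s n) * (√(s n))⁻¹ := by
          rw [Real.sqrt_div' _ (hs n).le, ← div_eq_mul_inv, div_div, hss]
          have := hs n
          gcongr
          exact hV n j
        simp only [integral_const, probReal_univ, one_smul]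
        gcongr
      refine squeeze_zero (fun n => integral_nonneg fun ω => Finset.sum_nonneg fun j _ => ?_) hcalc ?_
      · have := hs n
        positivity
      · have hsq : ∀ j < k, Tendsto (fun n => √((M n).card * p n j / s n)) atTop
            (𝓝 (√(1 / ((j : ℝ) + 1)))) := by
          intro j hj
          refine (Real.continuous_sqrt.tendsto _).comp ?_
          refine ((hratio j hj).div_const ((j : ℝ) + 1)).congr fun n => ?_
          have : (j : ℝ) + 1 ≠ 0 := by positivity
          field_simp
          rfl
        have : Tendsto (fun n => ∑ j ∈ Finset.range k,
            (((j : ℝ) + 1) * ((∫ ω, |N n j ω - C n j ω| ∂P) / √(s n)) * (√(s n))⁻¹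
              + (j + 1) * (√((M n).card * p n j / s n) * (√(s n))⁻¹)
              + |((j + 1) * ((M n).card * p n j) - s n) / √(s n)| * (√(s n))⁻¹)) atTop
            (𝓝 (∑ j ∈ Finset.range k, (((j : ℝ) + 1) * 0 * 0
              + (j + 1) * (√(1 / ((j : ℝ) + 1)) * 0) + |(0 : ℝ)| * 0))) := by
          refine tendsto_finsetSum _ fun j hj => ?_
          have hj' := Finset.mem_range.1 hj
          exact ((((herr j hj').const_mul _).mul hinv).add
            (((hsq j hj').mul hinv).const_mul _)).add ((hmean j hj').abs.mul hinv)
        simpa using this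
  -- Numerator and denominator are both divided by `s n`; the statistic is then a continuous
  -- function of `W` and `R⁻¹`, where `R⁻¹ → 1` in probability.
  have hfinal := hWlim.continuous_comp_prodMk_of_tendstoInMeasure_const
    (g := fun x : EuclideanSpace ℝ (Fin (k - 1)) × ℝ =>
      (∑ i : Fin (k - 1), limitWeight k (i + 1) * x.1 i ^ 2) * x.2) (by fun_prop)
    (tendstoInMeasure_inv_of_tendstoInMeasure_one hRlim) fun n => (hRmeas n).inv.aemeasurable
  refine hfinal.congr (fun n => Eventually.of_forall fun ω => ?_)
    (Eventually.of_forall fun ω => ?_)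
  · simp only [hW]
    rw [sum_limitWeight_mul_sq (k := k) fun j => ((j : ℝ) + 1) * N n j ω / √(s n)]
    have h1 : ∀ j : ℕ, (((j : ℝ) + 1) * N n j ω / √(s n)
        - 1 / k * ∑ l ∈ Finset.range k, ((l : ℝ) + 1) * N n l ω / √(s n)) ^ 2
        = (((j : ℝ) + 1) * N n j ω - 1 / k * ∑ l ∈ Finset.range k, ((l : ℝ) + 1) * N n l ω) ^ 2
          / s n := by
      intro j
      rw [← Finset.sum_div, ← mul_div_assoc, ← sub_div, div_pow, Real.sq_sqrt (hs n).le]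
    simp_rw [h1]
    rw [← Finset.sum_div, hR, inv_div]
    have := (hs n).ne'
    rw [div_mul_div_comm, mul_comm (s n), mul_div_mul_right _ _ this]
  · simp

end CountStatistic

/-! ### The D-norm of a grid indicator. -/

section DNorm

/-- Admitting finitely many discontinuities is what lets the functional expansion speak about finite
grids. -/
lemma isEMinus_indicator_neg_one {S : Set I} (hS : S.Finite) :
    IsEMinus (S.indicator fun _ => (-1 : ℝ)) where
  bounded := ⟨1, fun t => by by_cases h : t ∈ S <;> simp [h]⟩
  finite_discontinuities := by
    refine hS.subset fun t ht => ?_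
    by_contra hcon
    refine ht ?_
    have : S.indicator (fun _ => (-1 : ℝ)) =ᶠ[𝓝 t] fun _ => 0 := by
      filter_upwards [hS.isClosed.isOpen_compl.mem_nhds hcon] with x hx
      exact Set.indicator_of_notMem hx _
    exact continuousAt_const.congr this.symm
  nonpos t := by by_cases h : t ∈ S <;> simp [h]

variable {Ω₁ : Type*} [MeasurableSpace Ω₁] {Q : Measure Ω₁} [IsProbabilityMeasure Q]
  {Z : Ω₁ → C(I, ℝ)}

/-- The `D`-norm of the indicator of a finite nonempty set lies between `1` and the bound of the
generator. -/
lemma functionalDNorm_indicator_mem_Icc (hZ : IsGenerator Q Z) {q : ℝ}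
    (hq : ∀ᵐ ω ∂Q, ∀ t, 0 ≤ Z ω t ∧ Z ω t ≤ q) {S : Set I} (hS : S.Finite) (hne : S.Nonempty) :
    functionalDNorm Q Z (S.indicator fun _ => (-1 : ℝ)) ∈ Set.Icc 1 q := by
  obtain ⟨t₀, ht₀⟩ := hne
  have hcount : Countable S := hS.countable
  have hnon : Nonempty S := ⟨⟨t₀, ht₀⟩⟩
  set f : I → ℝ := S.indicator fun _ => (-1 : ℝ) with hf
  have hmeas : ∀ t, AEMeasurable (fun ω => Z ω t) Q := fun t =>
    (measurable_pi_apply t).comp_aemeasurable hZ.aemeasurable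
  have hle : ∀ ω, (∀ t, 0 ≤ Z ω t ∧ Z ω t ≤ q) → ∀ t, |f t| * Z ω t ≤ q := by
    intro ω hω t
    by_cases h : t ∈ S
    · simpa [hf, h] using (hω t).2
    · simpa [hf, h] using (hω t).1.trans (hω t).2
  have hbdd : ∀ ω, (∀ t, 0 ≤ Z ω t ∧ Z ω t ≤ q) →
      BddAbove (Set.range fun t => |f t| * Z ω t) := fun ω hω =>
    ⟨q, by rintro _ ⟨t, rfl⟩; exact hle ω hω t⟩
  have hge : ∀ ω, (∀ t, 0 ≤ Z ω t ∧ Z ω t ≤ q) → ∀ s ∈ S, Z ω s ≤ ⨆ t : I, |f t| * Z ω t := by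
    intro ω hω s hs
    have := le_ciSup (hbdd ω hω) s
    simpa [hf, hs] using this
  -- Points outside `S` contribute `0`, which is dominated by `Z ω t₀ ≥ 0`. Reducing to a supremum
  -- over the countable set `S` gives measurability.
  have hae : (fun ω => ⨆ t : I, |f t| * Z ω t) =ᵐ[Q] fun ω => ⨆ s : S, Z ω s := by
    filter_upwards [hq] with ω hω
    have hb : BddAbove (Set.range fun s : S => Z ω s) :=
      ⟨q, by rintro _ ⟨t, rfl⟩; exact (hω t).2⟩
    refine le_antisymm (ciSup_le fun t => ?_) (ciSup_le fun s => hge ω hω s s.2)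
    by_cases h : t ∈ S
    · simpa [hf, h] using le_ciSup hb ⟨t, h⟩
    · simpa [hf, h] using (hω t₀).1.trans (le_ciSup hb ⟨t₀, ht₀⟩)
  have hint : Integrable (fun ω => ⨆ t : I, |f t| * Z ω t) Q := by
    refine (MemLp.of_bound (p := 1) ?_ q ?_).integrable le_rfl
    · exact ((AEMeasurable.iSup fun s : S => hmeas s).congr hae.symm).aestronglyMeasurable
    · filter_upwards [hq] with ω hω
      rw [Real.norm_eq_abs, abs_of_nonneg ((hω t₀).1.trans (hge ω hω t₀ ht₀))]
      exact ciSup_le (hle ω hω)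
  have hint0 : Integrable (fun ω => Z ω t₀) Q := by
    refine (MemLp.of_bound (p := 1) (hmeas t₀).aestronglyMeasurable q ?_).integrable le_rfl
    filter_upwards [hq] with ω hω
    rw [Real.norm_eq_abs, abs_of_nonneg (hω t₀).1]
    exact (hω t₀).2
  unfold functionalDNorm
  constructor
  · rw [← hZ.integral_eq_one t₀]
    refine integral_mono_ae hint0 hint ?_
    filter_upwards [hq] with ω hω using hge ω hω t₀ ht₀
  · have := integral_mono_ae hint (integrable_const q) (by
      filter_upwards [hq] with ω hω using ciSup_le (hle ω hω))
    simpa using this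

end DNorm

/-! ### Exceedance of a high level on a grid. -/

section ExceedanceSet

variable {Ω : Type*} [MeasurableSpace Ω] {P : Measure Ω} [IsProbabilityMeasure P]
  {X : Ω → C(I, ℝ)}

/-- The paths whose copula transform exceeds `q` at some grid point. -/
def exceedanceSet (P : Measure Ω) (X : Ω → C(I, ℝ)) {d : ℕ} (t : Fin d → I) (q : ℝ) :
    Set (I → ℝ) :=
  {z | ∃ r, q < marginalCdf P X (t r) (z (t r))}

lemma measurableSet_exceedanceSet (hF : ∀ t, Continuous (marginalCdf P X t)) {d : ℕ}
    (t : Fin d → I) (q : ℝ) : MeasurableSet (exceedanceSet P X t q) := by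
  have : exceedanceSet P X t q = ⋃ r, {z | q < marginalCdf P X (t r) (z (t r))} := by
    ext z
    simp [exceedanceSet]
  rw [this]
  exact MeasurableSet.iUnion fun r => measurableSet_lt measurable_const
    ((hF (t r)).measurable.comp (measurable_pi_apply (t r)))

lemma exceedanceSet_anti {d : ℕ} (t : Fin d → I) {q q' : ℝ} (h : q ≤ q') :
    exceedanceSet P X t q' ⊆ exceedanceSet P X t q :=
  fun _ ⟨r, hr⟩ => ⟨r, h.trans_lt hr⟩

/-- Off the grid the constraint reads `U_u ≤ 1`, which always holds for a cdf value; only the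
finitely many grid constraints matter. -/
lemma measureReal_exceedanceSet (hX : AEMeasurable (fun ω (t : I) => X ω t) P)
    (hF : ∀ t, Continuous (marginalCdf P X t)) {d : ℕ} (t : Fin d → I) {c : ℝ} :
    (P.map fun ω (t : I) => X ω t).real (exceedanceSet P X t (1 - c))
      = 1 - P.real {ω | ∀ u, copulaProcess P X ω u
          ≤ 1 + c * (Set.range t).indicator (fun _ => (-1 : ℝ)) u} := by
  have := Measure.isProbabilityMeasure_map hX
  have hA := measurableSet_exceedanceSet hF t (1 - c)
  have hc := probReal_compl_eq_one_sub (μ := P.map fun ω (t : I) => X ω t) hA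
  rw [map_measureReal_apply_of_aemeasurable hX hA.compl] at hc
  rw [eq_sub_iff_add_eq, add_comm, ← eq_sub_iff_add_eq, ← hc]
  congr 1
  ext ω
  simp only [Set.mem_preimage, Set.mem_compl_iff, exceedanceSet, Set.mem_ofPred_eq, not_exists,
    not_lt]
  constructor
  · intro h r
    have := h (t r)
    rw [Set.indicator_of_mem (Set.mem_range_self r)] at this
    have h2 : marginalCdf P X (t r) (X ω (t r)) ≤ 1 + c * -1 := this
    linarith
  · intro h u
    by_cases hu : u ∈ Set.range t
    · obtain ⟨r, rfl⟩ := hu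
      rw [Set.indicator_of_mem (Set.mem_range_self r)]
      have := h r
      change marginalCdf P X (t r) (X ω (t r)) ≤ _
      linarith
    · rw [Set.indicator_of_notMem hu, mul_zero, add_zero]
      exact cdf_le_one _ _

end ExceedanceSet

/-! ### Rate of the misclassification error. -/

section Rates

/-- The normalized misclassification error is controlled by `d²/(mc)` and `m²c/n` alone. The `1` in
the numerator is absorbed using `m ≤ n`; the root term equals the second summand. -/
lemma mul_one_add_sqrt_div_sqrt_le {m d n c : ℝ} (hm : 0 < m) (hd : 0 ≤ d) (hmn : m ≤ n)
    (hc : 0 < c) :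
    m * d * ((1 + √(n * c)) / n) / √(m * c)
      ≤ √(d ^ 2 / (m * c)) + √(d ^ 2 / (m * c) * (m ^ 2 * c / n)) := by
  have hn : 0 < n := hm.trans_le hmn
  have h1 : √(d ^ 2 / (m * c)) = d / √(m * c) := by
    rw [Real.sqrt_div (sq_nonneg d), Real.sqrt_sq hd]
  have h2 : √(d ^ 2 / (m * c) * (m ^ 2 * c / n)) = m * d * √(n * c) / n / √(m * c) := by
    have hsq : d ^ 2 / (m * c) * (m ^ 2 * c / n) = (m * d * √(n * c) / n / √(m * c)) ^ 2 := by
      rw [div_pow, div_pow, mul_pow, Real.sq_sqrt (by positivity), Real.sq_sqrt (by positivity)]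
      field_simp
    rw [hsq, Real.sqrt_sq (by positivity)]
  rw [h1, h2]
  have h3 : m * d * ((1 + √(n * c)) / n) / √(m * c)
      = m / n * (d / √(m * c)) + m * d * √(n * c) / n / √(m * c) := by ring
  rw [h3]
  have h4 : m / n ≤ 1 := (div_le_one hn).2 hmn
  gcongr
  exact mul_le_of_le_one_left (by positivity) h4

end Rates

/-! ### From empirical to true marginal quantiles. -/

section TestStatistic

lemma sum_Icc_one_eq_sum_range (k : ℕ) (f : ℕ → ℝ) :
    ∑ j ∈ Finset.Icc 1 k, f j = ∑ j ∈ Finset.range k, f (j + 1) := by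
  rw [Finset.range_eq_Ico, Finset.sum_Ico_add' f 0 k 1]
  rfl

lemma testStatistic_eq (k n : ℕ) (M : Finset ℕ) {d : ℕ} (x : ℕ → Fin d → ℝ) (c : ℝ) :
    testStatistic k n M x c
      = (∑ j ∈ Finset.range k, (((j : ℝ) + 1) * exceedanceCount n M x c (j + 1)
          - 1 / k * ∑ l ∈ Finset.range k, ((l : ℝ) + 1) * exceedanceCount n M x c (l + 1)) ^ 2)
        / (1 / k * ∑ l ∈ Finset.range k, ((l : ℝ) + 1) * exceedanceCount n M x c (l + 1)) := by
  simp only [testStatistic, avgExceedance, sum_Icc_one_eq_sum_range]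
  push_cast
  rfl

lemma exceedanceCount_eq_sum (n : ℕ) (M : Finset ℕ) {d : ℕ} (x : ℕ → Fin d → ℝ) (c : ℝ) (j : ℕ) :
    (exceedanceCount n M x c j : ℝ) = ∑ i ∈ M,
      {x : ℕ → Fin d → ℝ | ∃ r, genInv (empiricalCdf n fun l => x l r) (1 - c / j) < x i r}.indicator
        1 x := by
  classical
  unfold exceedanceCount
  rw [← Finset.sum_boole]
  refine Finset.sum_congr rfl fun i _ => ?_
  rw [Set.indicator_apply]
  exact if_congr Iff.rfl rfl rfl

lemma measurable_exceedanceCount (n : ℕ) (M : Finset ℕ) (d : ℕ) (c : ℝ) (j : ℕ) :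
    Measurable fun x : ℕ → Fin d → ℝ => (exceedanceCount n M x c j : ℝ) := by
  simp_rw [exceedanceCount_eq_sum]
  refine Finset.measurable_sum _ fun i _ => measurable_one.indicator ?_
  have : {x : ℕ → Fin d → ℝ | ∃ r, genInv (empiricalCdf n fun l => x l r) (1 - c / j) < x i r}
      = ⋃ r, {x | genInv (empiricalCdf n fun l => x l r) (1 - c / j) < x i r} := by
    ext x
    simp
  rw [this]
  refine MeasurableSet.iUnion fun r => measurableSet_lt ?_ (by fun_prop)
  exact (measurable_genInv_empiricalCdf n (1 - c / j)).comp (by fun_prop)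

lemma exceedanceCount_le (n : ℕ) (M : Finset ℕ) {d : ℕ} (x : ℕ → Fin d → ℝ) (c : ℝ) (j : ℕ) :
    exceedanceCount n M x c j ≤ M.card := by
  unfold exceedanceCount
  exact Finset.card_filter_le _ _

variable {Ω : Type*} [MeasurableSpace Ω] {P : Measure Ω} [IsProbabilityMeasure P]
  {X : Ω → C(I, ℝ)}
  {Ω' : Type*} [MeasurableSpace Ω'] {P' : Measure Ω'} [IsProbabilityMeasure P']

/-- The counts based on empirical and on true marginal quantiles are close in `L¹`. -/
lemma integral_abs_exceedanceCount_sub_hitCount_le (hX : AEMeasurable (fun ω (t : I) => X ω t) P)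
    (hF : ∀ t, Continuous (marginalCdf P X t)) {y : ℕ → Ω' → I → ℝ} (hy : ∀ i, Measurable (y i))
    (hind : iIndepFun y P') (hlaw : ∀ i, P'.map (y i) = P.map fun ω (t : I) => X ω t)
    {d : ℕ} (t : Fin d → I) {n : ℕ} {M : Finset ℕ} (hM : M ⊆ Finset.range n) {c : ℝ} (hc : 0 < c)
    (hc1 : c < 1) (j : ℕ) :
    ∫ ω, |(exceedanceCount n M (fun i r => y i ω (t r)) c (j + 1) : ℝ)
        - hitCount M (exceedanceSet P X t (1 - c / ((j + 1 : ℕ) : ℝ))) y ω| ∂P'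
      ≤ M.card * d * ((1 + √(n * c)) / n) := by
  classical
  set q : ℝ := 1 - c / ((j + 1 : ℕ) : ℝ) with hq
  have hj : (1 : ℝ) ≤ ((j + 1 : ℕ) : ℝ) := by exact_mod_cast Nat.le_add_left 1 j
  have hcj : c / ((j + 1 : ℕ) : ℝ) ≤ c := div_le_self hc.le hj
  have hcj0 : 0 < c / ((j + 1 : ℕ) : ℝ) := by positivity
  set B : ℕ → Fin d → Set Ω' := fun i r => {ω | ¬(genInv (empiricalCdf n fun l => y l ω (t r)) q
    < y i ω (t r) ↔ q < marginalCdf P X (t r) (y i ω (t r)))} with hB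
  have hBmeas : ∀ i r, MeasurableSet (B i r) := fun i r =>
    (show Measurable fun ω l => y l ω (t r) by fun_prop)
      (measurableSet_quantileDiscrepancy n (hF (t r)).measurable q i)
  have hBle : ∀ i ∈ M, ∀ r, P'.real (B i r) ≤ (1 + √(n * c)) / n := by
    intro i hi r
    have hXt : AEMeasurable (fun ω => X ω (t r)) P := (measurable_pi_apply (t r)).comp_aemeasurable hX
    have := Measure.isProbabilityMeasure_map hXt
    refine (measureReal_quantileDiscrepancy_le (μ := P.map fun ω => X ω (t r))
      (x := fun l ω => y l ω (t r)) (fun l => (measurable_pi_apply (t r)).comp (hy l))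
      (hind.comp (fun _ z => z (t r)) fun _ => measurable_pi_apply (t r)) (fun l => ?_)
      (hF (t r)) (q := q) (by linarith) (by linarith) (Finset.mem_range.1 (hM hi))).trans ?_
    · change P'.map ((fun z : I → ℝ => z (t r)) ∘ y l) = _
      rw [← Measure.map_map (measurable_pi_apply (t r)) (hy l), hlaw l,
        AEMeasurable.map_map_of_aemeasurable (measurable_pi_apply (t r)).aemeasurable hX]
      rfl
    · gcongr
      linarith
  have hint : ∀ i r, Integrable (fun ω => (B i r).indicator (1 : Ω' → ℝ) ω) P' := fun i r =>
    (integrable_const (1 : ℝ)).indicator (hBmeas i r)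
  -- An observation counted differently by the two rules is misclassified in at least one component,
  -- whence a union bound over the grid.
  have hpt : ∀ ω, |(exceedanceCount n M (fun i r => y i ω (t r)) c (j + 1) : ℝ)
      - hitCount M (exceedanceSet P X t q) y ω|
      ≤ ∑ i ∈ M, ∑ r, (B i r).indicator (1 : Ω' → ℝ) ω := by
    intro ω
    rw [exceedanceCount_eq_sum, hitCount, ← Finset.sum_sub_distrib]
    refine (Finset.abs_sum_le_sum_abs _ _).trans (Finset.sum_le_sum fun i _ => ?_)
    have hnn : ∀ r, 0 ≤ (B i r).indicator (1 : Ω' → ℝ) ω := fun r =>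
      Set.indicator_nonneg (fun _ _ => zero_le_one) _
    by_cases hdis : ∃ r, ω ∈ B i r
    · obtain ⟨r, hr⟩ := hdis
      refine le_trans ?_ (Finset.single_le_sum (fun r _ => hnn r) (Finset.mem_univ r))
      rw [Set.indicator_of_mem hr, Set.indicator_apply, Set.indicator_apply]
      split_ifs <;> simp
    · have hagree : ∀ r, (genInv (empiricalCdf n fun l => y l ω (t r)) q < y i ω (t r)
          ↔ q < marginalCdf P X (t r) (y i ω (t r))) := by
        intro r
        by_contra hcon
        exact hdis ⟨r, hcon⟩
      have hiff : (fun i r => y i ω (t r)) ∈ {x : ℕ → Fin d → ℝ | ∃ r,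
          genInv (empiricalCdf n fun l => x l r) (1 - c / ((j + 1 : ℕ) : ℝ)) < x i r}
          ↔ y i ω ∈ exceedanceSet P X t q := exists_congr hagree
      refine le_trans (le_of_eq ?_) (Finset.sum_nonneg fun r _ => hnn r)
      rw [abs_eq_zero, sub_eq_zero, Set.indicator_apply, Set.indicator_apply]
      exact if_congr hiff rfl rfl
  calc _ ≤ ∫ ω, ∑ i ∈ M, ∑ r, (B i r).indicator (1 : Ω' → ℝ) ω ∂P' :=
        integral_mono_of_nonneg (Eventually.of_forall fun ω => abs_nonneg _)
          (integrable_finsetSum _ fun i _ => integrable_finsetSum _ fun r _ => hint i r)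
          (Eventually.of_forall hpt)
    _ = ∑ i ∈ M, ∑ r, P'.real (B i r) := by
        rw [integral_finsetSum _ fun i _ => integrable_finsetSum _ fun r _ => hint i r]
        refine Finset.sum_congr rfl fun i _ => ?_
        rw [integral_finsetSum _ fun r _ => hint i r]
        exact Finset.sum_congr rfl fun r _ => integral_indicator_one (hBmeas i r)
    _ ≤ ∑ i ∈ M, ∑ _r : Fin d, (1 + √(n * c)) / n :=
        Finset.sum_le_sum fun i hi => Finset.sum_le_sum fun r _ => hBle i hi r
    _ = M.card * d * ((1 + √(n * c)) / n) := by
        simp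
        ring

end TestStatistic

/-! ### Assembly, and transfer from the infinite product space. -/

section CanonicalSpace

variable {Ω : Type*} [MeasurableSpace Ω] {P : Measure Ω} [IsProbabilityMeasure P]
  {X : Ω → C(I, ℝ)}
  {Ω₁ : Type*} [MeasurableSpace Ω₁] {Q : Measure Ω₁} [IsProbabilityMeasure Q]
  {Z : Ω₁ → C(I, ℝ)}
  {Ω' : Type*} [MeasurableSpace Ω'] {P' : Measure Ω'} [IsProbabilityMeasure P']
  {Ω₃ : Type*} [MeasurableSpace Ω₃] {P₃ : Measure Ω₃} [IsProbabilityMeasure P₃]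

/-- The exceedance probability at a grid is asymptotically linear in the threshold, with slope
the `D`-norm of the grid indicator. -/
lemma exists_abs_measureReal_exceedanceSet_sub_le (hX : AEMeasurable (fun ω (t : I) => X ω t) P)
    (hF : ∀ t, Continuous (marginalCdf P X t)) {δ : ℝ}
    (hU : UniformDeltaNeighborhood P (copulaProcess P X) Q Z δ) :
    ∃ K > (0 : ℝ), ∃ c₀ > (0 : ℝ), ∀ (d : ℕ) (t : Fin d → I) (c : ℝ), 0 < c → c < c₀ →
      |(P.map fun ω (t : I) => X ω t).real (exceedanceSet P X t (1 - c))
        - c * functionalDNorm Q Z ((Set.range t).indicator fun _ => (-1 : ℝ))|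
        ≤ K * c ^ (1 + δ) := by
  obtain ⟨K, hK, c₀, hc₀, h⟩ := hU
  refine ⟨K, hK, c₀, hc₀, fun d t c hc hc1 => ?_⟩
  have := h _ (isEMinus_indicator_neg_one (Set.finite_range t))
    (fun u => by by_cases hu : u ∈ Set.range t <;> simp [hu, -Set.mem_range]) c hc hc1
  rw [measureReal_exceedanceSet hX hF, ← abs_neg]
  convert this using 2
  ring

/-- The limit theorem for everywhere measurable independent copies. -/
theorem tendstoInDistribution_testStatistic_of_measurable
    (hX : AEMeasurable (fun ω (t : I) => X ω t) P)
    (hF : ∀ t, Continuous (marginalCdf P X t)) (hZ : IsGenerator Q Z)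
    {δ : ℝ} (hδ : 0 < δ) (hU : UniformDeltaNeighborhood P (copulaProcess P X) Q Z δ)
    {y : ℕ → Ω' → I → ℝ} (hy : ∀ i, Measurable (y i))
    (hind : iIndepFun y P') (hlaw : ∀ i, P'.map (y i) = P.map fun ω (t : I) => X ω t)
    {d : ℕ → ℕ} {t : (n : ℕ) → Fin (d n) → I} (hd : ∀ n, 0 < d n)
    {k : ℕ} (hk : 0 < k) {M : ℕ → Finset ℕ} (hM : ∀ n, M n ⊆ Finset.range n) {c : ℕ → ℝ}
    (hm : Tendsto (fun n => (M n).card) atTop atTop) (hc : Tendsto c atTop (𝓝 0))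
    (hmc : Tendsto (fun n => ((M n).card : ℝ) * c n) atTop atTop)
    (hmcδ : Tendsto (fun n => ((M n).card : ℝ) * c n ^ (1 + δ)) atTop (𝓝 0))
    (hmn : Tendsto (fun n => ((M n).card : ℝ) ^ 2 * c n / (n : ℝ)) atTop (𝓝 0))
    (hdmc : Tendsto (fun n => (d n : ℝ) ^ 2 / (((M n).card : ℝ) * c n)) atTop (𝓝 0))
    {ξ : Fin (k - 1) → Ω₃ → ℝ} (hξ : ∀ i, HasLaw (ξ i) (gaussianReal 0 1) P₃)
    (hξind : iIndepFun ξ P₃) :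
    TendstoInDistribution
      (fun n ω => testStatistic k n (M n) (fun i r => y i ω (t n r)) (c n)) atTop
      (fun ω => ∑ i : Fin (k - 1), limitWeight k (i + 1) * ξ i ω ^ 2) (fun _ => P') P₃ := by
  have := Measure.isProbabilityMeasure_map hX
  set μ := P.map fun ω (t : I) => X ω t with hμ
  obtain ⟨K, hK, c₀, hc₀, hexp⟩ := exists_abs_measureReal_exceedanceSet_sub_le hX hF hU
  obtain ⟨q, hq⟩ := hZ.bounded
  set D : ℕ → ℝ := fun n =>
    functionalDNorm Q Z ((Set.range (t n)).indicator fun _ => (-1 : ℝ)) with hD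
  have hDq : ∀ n, D n ∈ Set.Icc 1 q := fun n =>
    functionalDNorm_indicator_mem_Icc hZ hq (Set.finite_range _) ⟨_, Set.mem_range_self ⟨0, hd n⟩⟩
  -- The asymptotic common mean of the weighted counts; the maximum with `1` only secures positivity
  -- for every `n` and is eventually inactive.
  set s : ℕ → ℝ := fun n => max ((M n).card * c n * D n) 1 with hs
  have hs1 : ∀ n, 1 ≤ s n := fun n => le_max_right _ _
  have hs0 : ∀ n, 0 < s n := fun n => one_pos.trans_le (hs1 n)
  have hcpos : ∀ᶠ n in atTop, 0 < c n := by
    filter_upwards [hmc.eventually_gt_atTop 0] with n hn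
    exact pos_of_mul_pos_right hn (Nat.cast_nonneg _)
  have hsge : ∀ᶠ n in atTop, (M n).card * c n ≤ s n := by
    filter_upwards [hmc.eventually_gt_atTop 0] with n hn
    exact (le_mul_of_one_le_right hn.le (hDq n).1).trans (le_max_left _ _)
  have hseq : ∀ᶠ n in atTop, s n = (M n).card * c n * D n := by
    filter_upwards [hmc.eventually_ge_atTop 1] with n hn
    exact max_eq_left (hn.trans (le_mul_of_one_le_right (by linarith) (hDq n).1))
  have hs_atTop : Tendsto s atTop atTop := tendsto_atTop_mono' _ hsge hmc
  have hcsmall : ∀ᶠ n in atTop, c n < min c₀ 1 :=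
    hc.eventually_lt_const (lt_min hc₀ one_pos)
  have hj1 : ∀ j : ℕ, (1 : ℝ) ≤ ((j + 1 : ℕ) : ℝ) := fun j => by
    exact_mod_cast Nat.le_add_left 1 j
  set A : ℕ → ℕ → Set (I → ℝ) := fun n j =>
    exceedanceSet P X (t n) (1 - c n / ((j + 1 : ℕ) : ℝ)) with hA
  have hprob : ∀ j : ℕ, ∀ᶠ n in atTop,
      |μ.real (A n j) - c n / ((j + 1 : ℕ) : ℝ) * D n| ≤ K * c n ^ (1 + δ) := by
    intro j
    filter_upwards [hcpos, hcsmall] with n hn hn1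
    have hle : c n / ((j + 1 : ℕ) : ℝ) ≤ c n := div_le_self hn.le (hj1 j)
    have hpos : 0 < c n / ((j + 1 : ℕ) : ℝ) := by positivity
    refine (hexp (d n) (t n) _ hpos (hle.trans_lt (hn1.trans_le (min_le_left _ _)))).trans ?_
    gcongr
  have hpow : ∀ᶠ n in atTop, c n ^ (1 + δ) ≤ c n := by
    filter_upwards [hcpos, hcsmall] with n hn hn1
    exact Real.rpow_le_self_of_le_one hn.le (hn1.trans_le (min_le_right _ _)).le (by linarith)
  have hmain := tendstoInDistribution_count_statistic (μ := μ) (s := s) hk hy hind hlaw (A := A)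
    (fun n j => measurableSet_exceedanceSet hF _ _) hm hs0 hs_atTop ?_ ?_ ?_
    (N := fun n j ω => (exceedanceCount n (M n) (fun i r => y i ω (t n r)) (c n) (j + 1) : ℝ))
    ?_ ?_ ?_ hξ hξind
  · refine hmain.congr (fun n => Eventually.of_forall fun ω => ?_) (ae_eq_refl _)
    exact (testStatistic_eq _ _ _ _ _).symm
  · filter_upwards [hcpos] with n hn j l hjl _
    refine exceedanceSet_anti _ ?_
    gcongr
  · intro j _
    have hlim : Tendsto (fun n => c n * (q + K)) atTop (𝓝 0) := by simpa using hc.mul_const (q + K)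
    refine squeeze_zero' (Eventually.of_forall fun n => measureReal_nonneg) ?_ hlim
    filter_upwards [hprob j, hpow, hcpos] with n h1 h2 h3
    have hle : c n / ((j + 1 : ℕ) : ℝ) ≤ c n := div_le_self h3.le (hj1 j)
    have h4 : c n / ((j + 1 : ℕ) : ℝ) * D n ≤ c n * q :=
      mul_le_mul hle (hDq n).2 (zero_le_one.trans (hDq n).1) h3.le
    have h5 : K * c n ^ (1 + δ) ≤ K * c n := by gcongr
    have := (abs_le.1 h1).2
    linarith
  -- The bias is at most `(j+1) K m c^(1+δ)`, which vanishes even before division by `√(s n) ≥ 1`.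
  · intro j _
    have hlim : Tendsto (fun n => ((j + 1 : ℕ) : ℝ) * K * ((M n).card * c n ^ (1 + δ))) atTop
        (𝓝 0) := by simpa using hmcδ.const_mul (((j + 1 : ℕ) : ℝ) * K)
    refine squeeze_zero_norm' ?_ hlim
    filter_upwards [hprob j, hseq] with n h1 h2
    have hj0 : ((j + 1 : ℕ) : ℝ) ≠ 0 := by positivity
    have e1 : ((j : ℝ) + 1) * ((M n).card * μ.real (A n j)) - s n
        = ((j + 1 : ℕ) : ℝ) * (M n).card * (μ.real (A n j) - c n / ((j + 1 : ℕ) : ℝ) * D n) := by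
      rw [h2, mul_sub]
      push_cast at hj0 ⊢
      field_simp
    rw [Real.norm_eq_abs, abs_div, abs_of_nonneg (Real.sqrt_nonneg _), e1, abs_mul,
      abs_of_nonneg (by positivity : (0 : ℝ) ≤ ((j + 1 : ℕ) : ℝ) * (M n).card)]
    refine (div_le_self (by positivity) (Real.one_le_sqrt.2 (hs1 n))).trans ?_
    calc _ ≤ ((j + 1 : ℕ) : ℝ) * (M n).card * (K * c n ^ (1 + δ)) := by gcongr
      _ = _ := by ring
  · intro n j
    exact (measurable_exceedanceCount n (M n) (d n) (c n) (j + 1)).comp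
      (show Measurable fun ω i r => y i ω (t n r) by fun_prop)
  · intro n j
    refine (MemLp.of_bound (p := 1) ?_ ((M n).card : ℝ)
      (Eventually.of_forall fun ω => ?_)).integrable le_rfl
    · exact ((measurable_exceedanceCount n (M n) (d n) (c n) (j + 1)).comp
        (show Measurable fun ω i r => y i ω (t n r) by fun_prop)).aestronglyMeasurable
    · rw [Real.norm_eq_abs, abs_of_nonneg (Nat.cast_nonneg _)]
      exact_mod_cast exceedanceCount_le _ _ _ _ _
  -- Since `D n ≥ 1`, eventually `s n ≥ m c`, so dividing by `√(m c)` suffices.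
  · intro j _
    have hlim : Tendsto (fun n => √((d n : ℝ) ^ 2 / ((M n).card * c n))
        + √((d n : ℝ) ^ 2 / ((M n).card * c n) * (((M n).card : ℝ) ^ 2 * c n / n))) atTop (𝓝 0) := by
      have h1 := (Real.continuous_sqrt.tendsto _).comp hdmc
      have h2 := (Real.continuous_sqrt.tendsto _).comp (hdmc.mul hmn)
      simpa [Function.comp_def] using h1.add h2
    refine squeeze_zero' (Eventually.of_forall fun n => by positivity) ?_ hlim
    filter_upwards [hcpos, hcsmall, hsge, hm.eventually_gt_atTop 0] with n h1 h2 h3 h4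
    have hm0 : (0 : ℝ) < (M n).card := by exact_mod_cast h4
    have hcard : ((M n).card : ℝ) ≤ n := by
      exact_mod_cast (Finset.card_le_card (hM n)).trans (Finset.card_range n).le
    refine le_trans ?_ (mul_one_add_sqrt_div_sqrt_le hm0 (Nat.cast_nonneg (d n)) hcard h1)
    have hL := integral_abs_exceedanceCount_sub_hitCount_le hX hF hy hind hlaw (t n) (hM n) h1
      (h2.trans_le (min_le_right _ _)) j
    gcongr

end CanonicalSpace

theorem mainTheorem7
    -- the process `X` in `C[0,1]`
    {Ω : Type*} [MeasurableSpace Ω] (P : Measure Ω) [IsProbabilityMeasure P]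
    (X : Ω → C(I, ℝ))
    (hFcont : ∀ t, Continuous (marginalCdf P X t))
    -- the generator process `Z` of the `D`-norm
    {Ω₁ : Type*} [MeasurableSpace Ω₁] (Q : Measure Ω₁) [IsProbabilityMeasure Q]
    (Z : Ω₁ → C(I, ℝ)) (hZ : IsGenerator Q Z)
    (δ : ℝ) (hδ : 0 < δ)
    (hU : UniformDeltaNeighborhood P (copulaProcess P X) Q Z δ)
    -- independent copies of `X`
    {Ω₂ : Type*} [MeasurableSpace Ω₂] (P₂ : Measure Ω₂) [IsProbabilityMeasure P₂]
    (Y : ℕ → Ω₂ → C(I, ℝ))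
    (hY_indep : iIndepFun (fun i ω (t : I) => Y i ω t) P₂)
    (hY_law : ∀ i, IdentDistrib (fun ω (t : I) => Y i ω t) (fun ω (t : I) => X ω t) P₂ P)
    -- the grids
    (d : ℕ → ℕ) (t : (n : ℕ) → Fin (d n) → I) (ht : ∀ n, IsGrid (t n))
    (hd : Tendsto d atTop atTop)
    (hmesh : Tendsto (fun n => gridMesh (t n)) atTop (𝓝 0))
    -- the index sets `M(n)`, the thresholds `c_n`, and the rate conditions
    (k : ℕ) (hk : 2 ≤ k)
    (M : ℕ → Finset ℕ) (hM : ∀ n, M n ⊆ Finset.range n)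
    (c : ℕ → ℝ)
    (hm : Tendsto (fun n => (M n).card) atTop atTop)
    (hc : Tendsto c atTop (𝓝 0))
    (hmc : Tendsto (fun n => ((M n).card : ℝ) * c n) atTop atTop)
    (hmcδ : Tendsto (fun n => ((M n).card : ℝ) * c n ^ (1 + δ)) atTop (𝓝 0))
    (hlog : Tendsto (fun n => ((M n).card : ℝ) ^ 2 * Real.log ((M n).card : ℝ) * c n / (n : ℝ))
      atTop (𝓝 0))
    (hdmc : Tendsto (fun n => (d n : ℝ) ^ 2 / (((M n).card : ℝ) * c n)) atTop (𝓝 0))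
    -- independent standard normal variables
    {Ω₃ : Type*} [MeasurableSpace Ω₃] (P₃ : Measure Ω₃) [IsProbabilityMeasure P₃]
    (ξ : Fin (k - 1) → Ω₃ → ℝ)
    (hξ_law : ∀ i, HasLaw (ξ i) (gaussianReal 0 1) P₃)
    (hξ_indep : iIndepFun ξ P₃) :
    TendstoInDistribution
      (fun n ω => testStatistic k n (M n) (fun i r => Y i ω (t n r)) (c n))
      atTop
      (fun ω => ∑ i : Fin (k - 1), limitWeight k (i + 1) * ξ i ω ^ 2)
      (fun _ => P₂) P₃ := by
  have hX : AEMeasurable (fun ω (t : I) => X ω t) P := (hY_law 0).aemeasurable_snd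
  have := Measure.isProbabilityMeasure_map hX
  set μ := P.map fun ω (t : I) => X ω t with hμ
  set ν := Measure.infinitePi fun _ : ℕ => μ with hν
  have hYmeas : AEMeasurable (fun ω i (t : I) => Y i ω t) P₂ :=
    aemeasurable_pi_lambda _ fun i => (hY_law i).aemeasurable_fst
  have hYmap : P₂.map (fun ω i (t : I) => Y i ω t) = ν := by
    rw [hY_indep.map_fun_eq_infinitePi_map₀ hYmeas]
    congr 1
    ext1 i
    exact (hY_law i).map_eq
  have hmpos : ∀ᶠ n in atTop, 0 < ((M n).card : ℝ) * c n := hmc.eventually_gt_atTop 0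
  -- The logarithm is eventually at least `1`, so it can be dropped.
  have hmn : Tendsto (fun n => ((M n).card : ℝ) ^ 2 * c n / (n : ℝ)) atTop (𝓝 0) := by
    have hlogm : ∀ᶠ n in atTop, 1 ≤ Real.log ((M n).card : ℝ) :=
      (Real.tendsto_log_atTop.comp (tendsto_natCast_atTop_atTop.comp hm)).eventually_ge_atTop 1
    refine squeeze_zero' ?_ ?_ hlog
    · filter_upwards [hmpos] with n hn
      have : 0 < c n := pos_of_mul_pos_right hn (Nat.cast_nonneg _)
      positivity
    · filter_upwards [hmpos, hlogm] with n hn hn1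
      have : 0 < c n := pos_of_mul_pos_right hn (Nat.cast_nonneg _)
      gcongr
      exact le_mul_of_one_le_right (sq_nonneg _) hn1
  have hdpos : ∀ n, 0 < d n := fun n => by
    obtain ⟨r, _⟩ := (ht n).zero_mem
    exact r.pos
  -- The given copies are only almost everywhere measurable. Convergence in distribution depends
  -- only on the law of the whole sequence, so it is proved for the coordinates under the product
  -- measure and pulled back.
  have hcan := tendstoInDistribution_testStatistic_of_measurable (P' := ν) hX hFcont hZ hδ hU
    (y := fun i x => x i) (fun i => measurable_pi_apply i)
    (iIndepFun_infinitePi (X := fun _ x => x) fun _ => measurable_id)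
    (fun i => Measure.infinitePi_map_eval _ i) (t := t) hdpos (by omega : 0 < k) hM hm hc hmc hmcδ
    hmn hdmc hξ_law hξ_indep
  have hTmeas : ∀ n, Measurable fun x : ℕ → I → ℝ =>
      testStatistic k n (M n) (fun i r => x i (t n r)) (c n) := by
    intro n
    simp_rw [testStatistic_eq]
    have h1 : ∀ j, Measurable fun x : ℕ → I → ℝ =>
        (exceedanceCount n (M n) (fun i r => x i (t n r)) (c n) j : ℝ) := fun j =>
      (measurable_exceedanceCount n (M n) (d n) (c n) j).comp
        (show Measurable fun (x : ℕ → I → ℝ) i r => x i (t n r) by fun_prop)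
    fun_prop
  refine ⟨fun n => (hTmeas n).comp_aemeasurable hYmeas, hcan.aemeasurable_limit, ?_⟩
  refine hcan.tendsto.congr fun n => Subtype.ext ?_
  change ν.map _ = P₂.map ((fun x : ℕ → I → ℝ =>
    testStatistic k n (M n) (fun i r => x i (t n r)) (c n)) ∘ fun ω i (t : I) => Y i ω t)
  rw [← AEMeasurable.map_map_of_aemeasurable (hTmeas n).aemeasurable hYmeas, hYmap]
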